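/- Let $n\ge 2$, let $\Omega\subset\mathbb{R}^n$ be a bounded Lipschitz domain with $0\in\Omega$ (the result below holds for every bounded open $\Omega\ni 0$), and let $\Gamma=\{x\in\Omega:\ x_n=0\}$. Let $R\in(0,1/2)$ be a constant and, for small $\varepsilon>0$, let $d^\varepsilon,\alpha^\varepsilon,\beta^\varepsilon>0$ with $d^\varepsilon=o(\varepsilon)$ as $\varepsilon\to0^+$. For $i\in\mathbb{Z}^{n-1}$ put $x^{i,\varepsilon}=(\varepsilon i_1,\dots,\varepsilon i_{n-1},0)$, $$D_i^\varepsilon=\{x:\ R\varepsilon-d^\varepsilon<|x-x^{i,\varepsilon}|<R\varepsilon\},\qquad B_i^\varepsilon=\{x:\ |x-x^{i,\varepsilon}|<R\varepsilon-d^\varepsilon\},$$ and let $\mathcal{I}^\varepsilon$ be the set of those $i$ for which $x^{i,\varepsilon}\in\Gamma$ and $\mathrm{dist}(x^{i,\varepsilon},\partial\Omega)\ge\varepsilon\sqrt n/2$. Let $a^\varepsilon=\alpha^\varepsilon$ on $\bigcup_{i\in\mathcal{I}^\varepsilon}D_i^\varepsilon$ and $a^\varepsilon=1$ elsewhere in $\Omega$;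 let $b^\varepsilon=\beta^\varepsilon$ on $\bigcup_{i\in\mathcal{I}^\varepsilon}B_i^\varepsilon$ and $b^\varepsilon=1$ elsewhere in $\Omega$. Let $\mathcal{A}^\varepsilon=-\frac1{b^\varepsilon}\mathrm{div}(a^\varepsilon\nabla)$ with Dirichlet boundary conditions, that is, the self-adjoint operator in $L^2(\Omega;b^\varepsilon dx)$ associated with the form $\eta^\varepsilon[u,v]=\int_\Omega a^\varepsilon\nabla u\cdot\nabla\bar v\,dx$, $\mathrm{dom}(\eta^\varepsilon)=H^1_0(\Omega)$. Suppose that, as $\varepsilon\to0^+$, $$\frac{(d^\varepsilon)^2}{\alpha^\varepsilon}\to0,\qquad \frac{\alpha^\varepsilon n}{R\,d^\varepsilon\varepsilon\beta^\varepsilon}\to q\in[0,\infty],\qquad R^n\varkappa_n\,\varepsilon\beta^\varepsilon\to r\in[0,\infty),$$ where $\varkappa_n$ is the volume of the unit ball of $\mathbb{R}^n$. Then, for all sufficiently small $\varepsilon>0$, the eigenvalues of $\mathcal{A}^\varepsilon$ can be written as a sequence $\lambda_1^\varepsilon\le\lambda_2^\varepsilon\le\cdots$ in ascending order and repeated according to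 multiplicity, and $$\sup_{k\in\mathbb{N}}\Big(\limsup_{\varepsilon\to0^+}\lambda_k^\varepsilon\Big)\le q .$$ In particular, if $q=0$, then $\lambda_k^\varepsilon\to0$ as $\varepsilon\to0^+$ for every $k$. -/

import Mathlib

open MeasureTheory Filter Topology Set
open scoped ENNReal ContDiff

noncomputable section

namespace DoubleContrast

/-- The space `ℝⁿ` with `n = m + 1`; the last coordinate is the one written `x_n`. -/
abbrev Space (m : ℕ) : Type := EuclideanSpace ℝ (Fin (m + 1))

/-! ### The geometry and the coefficients -/

/-- `Γ`, the part of the hyperplane `{x_n = 0}` inside `Ω`. -/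
def interface {m : ℕ} (Ω : Set (Space m)) : Set (Space m) :=
  {x | x ∈ Ω ∧ x (Fin.last m) = 0}

/-- The point `(ε i₁, …, ε i_{n-1}, 0)`. -/
def latticePoint {m : ℕ} (ε : ℝ) (i : Fin m → ℤ) : Space m :=
  WithLp.toLp 2 (Fin.snoc (α := fun _ => ℝ) (fun j => ε * (i j : ℝ)) 0)

/-- The indices of the lattice points on `Γ` at distance at least `ε √n / 2` from `∂Ω`. -/
def admissible {m : ℕ} (Ω : Set (Space m)) (ε : ℝ) : Set (Fin m → ℤ) :=
  {i | latticePoint ε i ∈ interface Ω ∧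
    ε * (Real.sqrt ((m : ℝ) + 1) / 2) ≤ Metric.infDist (latticePoint ε i) (frontier Ω)}

/-- The spherical shell with centre `c`, outer radius `ρ` and thickness `d`. -/
def shell {m : ℕ} (c : Space m) (ρ d : ℝ) : Set (Space m) :=
  {x | ρ - d < dist x c ∧ dist x c < ρ}

/-- The ball surrounded by that shell. -/
def core {m : ℕ} (c : Space m) (ρ d : ℝ) : Set (Space m) :=
  {x | dist x c < ρ - d}

/-- The union of all shells, of outer radius `R ε` and thickness `d`. -/
def shells {m : ℕ} (Ω : Set (Space m)) (R ε d : ℝ) : Set (Space m) :=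
  ⋃ i ∈ admissible Ω ε, shell (latticePoint ε i) (R * ε) d

/-- The union of all the balls surrounded by the shells. -/
def cores {m : ℕ} (Ω : Set (Space m)) (R ε d : ℝ) : Set (Space m) :=
  ⋃ i ∈ admissible Ω ε, core (latticePoint ε i) (R * ε) d

open Classical in
/-- The function equal to `c` on `S` and to `1` elsewhere. -/
def stepFun {m : ℕ} (S : Set (Space m)) (c : ℝ) : Space m → ℝ :=
  fun x => if x ∈ S then c else 1

/-- The stiffness `a^ε`: the constant `α` on the shells, `1` elsewhere. -/
def stiffness {m : ℕ} (Ω : Set (Space m)) (R ε d α : ℝ) : Space m → ℝ :=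
  stepFun (shells Ω R ε d) α

/-- The density `b^ε`: the constant `β` on the balls inside the shells, `1` elsewhere. -/
def density {m : ℕ} (Ω : Set (Space m)) (R ε d β : ℝ) : Space m → ℝ :=
  stepFun (cores Ω R ε d) β

/-- Bounded measurable real coefficients. -/
def IsCoeff {m : ℕ} (w : Space m → ℝ) : Prop :=
  Measurable w ∧ ∃ C : ℝ, ∀ x, |w x| ≤ C

theorem isCoeff_stepFun {m : ℕ} {S : Set (Space m)} (hS : MeasurableSet S) (c : ℝ) :
    IsCoeff (stepFun S c) := by
  classical
  refine ⟨Measurable.ite hS measurable_const measurable_const, max |c| 1, fun x => ?_⟩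
  unfold stepFun
  split_ifs <;> simp

theorem isCoeff_stiffness {m : ℕ} (Ω : Set (Space m)) (R ε d α : ℝ) :
    IsCoeff (stiffness Ω R ε d α) := by
  refine isCoeff_stepFun (IsOpen.measurableSet ?_) α
  refine isOpen_biUnion fun i _ => ?_
  exact (isOpen_lt continuous_const (continuous_id.dist continuous_const)).inter
    (isOpen_lt (continuous_id.dist continuous_const) continuous_const)

theorem isCoeff_density {m : ℕ} (Ω : Set (Space m)) (R ε d β : ℝ) :
    IsCoeff (density Ω R ε d β) := by
  refine isCoeff_stepFun (IsOpen.measurableSet ?_) β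
  refine isOpen_biUnion fun i _ => ?_
  exact isOpen_lt (continuous_id.dist continuous_const) continuous_const

/-! ### The spaces `L²(Ω)` and `H¹₀(Ω)` -/

/-- `L²(Ω; F)` with respect to Lebesgue measure. -/
abbrev L2 {m : ℕ} (Ω : Set (Space m)) (F : Type) [NormedAddCommGroup F] : Type :=
  Lp F 2 ((volume : Measure (Space m)).restrict Ω)

/-- The values of gradients of complex functions. -/
abbrev Grad (m : ℕ) : Type := EuclideanSpace ℂ (Fin (m + 1))

/-- `φ ∈ C_c^∞(Ω)`, complex valued. -/
def IsTest {m : ℕ} (Ω : Set (Space m)) (φ : Space m → ℂ) : Prop :=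
  ContDiff ℝ ∞ φ ∧ HasCompactSupport φ ∧ tsupport φ ⊆ Ω

/-- The classical gradient `(∂₁φ, …, ∂_nφ)`. -/
def classicalGrad {m : ℕ} (φ : Space m → ℂ) (x : Space m) : Grad m :=
  WithLp.toLp 2 fun j => fderiv ℝ φ x (EuclideanSpace.single j 1)

/-- `H¹₀(Ω)`, the closure of `C_c^∞(Ω)` in the `H¹` norm. An element `u` is represented by the pair
`(u, ∇u)` of `L²(Ω) × L²(Ω)ⁿ`, so this is the closure of the pairs `(φ, ∇φ)` with `φ` a test
function; the second entry of a pair is the weak gradient of the first and is determined by it. -/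
def H10 {m : ℕ} (Ω : Set (Space m)) : Submodule ℂ (L2 Ω ℂ × L2 Ω (Grad m)) :=
  (Submodule.span ℂ {p : L2 Ω ℂ × L2 Ω (Grad m) | ∃ φ : Space m → ℂ, IsTest Ω φ ∧
    p.1 =ᵐ[volume.restrict Ω] φ ∧
    p.2 =ᵐ[volume.restrict Ω] classicalGrad φ}).topologicalClosure

/-- Pairs in `H¹₀(Ω)` satisfy the integration by parts formula of weak derivatives. -/
theorem H10_weak_gradient {m : ℕ} {Ω : Set (Space m)} {u : L2 Ω ℂ} {g : L2 Ω (Grad m)}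
    (h : (u, g) ∈ H10 Ω) {ψ : Space m → ℝ} (hψ : ContDiff ℝ ∞ ψ) (hc : HasCompactSupport ψ)
    (hs : tsupport ψ ⊆ Ω) (j : Fin (m + 1)) :
    ∫ x in Ω, ψ x • g x j = -∫ x in Ω, fderiv ℝ ψ x (EuclideanSpace.single j 1) • u x := by
  set e : Space m := EuclideanSpace.single j 1 with he
  set μ : Measure (Space m) := volume.restrict Ω with hμ
  have hdc : Continuous fun x => fderiv ℝ ψ x e :=
    (hψ.continuous_fderiv (by simp)).clm_apply continuous_const
  have hdcs : HasCompactSupport fun x => fderiv ℝ ψ x e := hc.fderiv_apply (𝕜 := ℝ) e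
  have hP : MemLp (fun x => (ψ x : ℂ) • (EuclideanSpace.single j 1 : Grad m)) 2 μ := by
    refine Continuous.memLp_of_hasCompactSupport ?_ ?_
    · exact (Complex.continuous_ofReal.comp hψ.continuous).smul continuous_const
    · exact hc.comp_left (g := fun t : ℝ => (t : ℂ) • (EuclideanSpace.single j 1 : Grad m))
        (by simp)
  have hQ : MemLp (fun x => ((fderiv ℝ ψ x e : ℝ) : ℂ)) 2 μ :=
    (Complex.continuous_ofReal.comp hdc).memLp_of_hasCompactSupport
      (hdcs.comp_left (g := fun t : ℝ => (t : ℂ)) (by simp))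
  let ℓ : L2 Ω ℂ × L2 Ω (Grad m) →L[ℂ] ℂ :=
    (innerSL ℂ hQ.toLp).comp (ContinuousLinearMap.fst ℂ _ _) +
      (innerSL ℂ hP.toLp).comp (ContinuousLinearMap.snd ℂ _ _)
  have key : ∀ p : L2 Ω ℂ × L2 Ω (Grad m),
      ℓ p = (∫ x in Ω, fderiv ℝ ψ x e • p.1 x) + ∫ x in Ω, ψ x • p.2 x j := by
    intro p
    change inner ℂ hQ.toLp p.1 + inner ℂ hP.toLp p.2 = _
    rw [L2.inner_def, L2.inner_def]
    congr 1
    · refine integral_congr_ae ?_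
      filter_upwards [hQ.coeFn_toLp] with x hx
      rw [hx]; simp [mul_comm]
    · refine integral_congr_ae ?_
      filter_upwards [hP.coeFn_toLp] with x hx
      rw [hx, inner_smul_left, EuclideanSpace.inner_single_left]
      simp [Complex.real_smul]
  have hle : H10 Ω ≤ ℓ.toLinearMap.ker := by
    refine Submodule.topologicalClosure_minimal _ (Submodule.span_le.2 ?_)
      (ContinuousLinearMap.isClosed_ker ℓ)
    rintro p ⟨φ, ⟨hφ, hφc, hφs⟩, h1, h2⟩
    change ℓ p = 0
    rw [key]
    have e1 : ∫ x in Ω, fderiv ℝ ψ x e • p.1 x = ∫ x, fderiv ℝ ψ x e • φ x := by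
      rw [integral_congr_ae (g := fun x => fderiv ℝ ψ x e • φ x)
        (h1.mono fun x hx => by simp only [hx])]
      refine setIntegral_eq_integral_of_forall_compl_eq_zero fun x hx => ?_
      rw [image_eq_zero_of_notMem_tsupport fun h => hx (hφs h), smul_zero]
    have e2 : ∫ x in Ω, ψ x • p.2 x j = ∫ x, ψ x • fderiv ℝ φ x e := by
      rw [integral_congr_ae (g := fun x => ψ x • fderiv ℝ φ x e)
        (h2.mono fun x hx => by simp only [hx]; rfl)]
      refine setIntegral_eq_integral_of_forall_compl_eq_zero fun x hx => ?_
      rw [image_eq_zero_of_notMem_tsupport fun h => hx (hs h), zero_smul]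
    rw [e1, e2, add_comm, integral_smul_fderiv_eq_neg_fderiv_smul_of_integrable (𝕜 := ℝ),
      neg_add_cancel]
    · exact (hdc.smul hφ.continuous).integrable_of_hasCompactSupport hdcs.smul_right
    · exact (hψ.continuous.smul ((hφ.continuous_fderiv (by simp)).clm_apply
        continuous_const)).integrable_of_hasCompactSupport hc.smul_right
    · exact (hψ.continuous.smul hφ.continuous).integrable_of_hasCompactSupport hc.smul_right
    · exact fun x _ => hψ.differentiable (by simp) x
    · exact fun x _ => hφ.differentiable (by simp) x
  have h0 : ℓ (u, g) = 0 := hle h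
  rw [key] at h0
  exact eq_neg_of_add_eq_zero_right h0

/-- The weak gradient is determined by the function. -/
theorem H10_snd_eq_zero {m : ℕ} {Ω : Set (Space m)} (hΩ : IsOpen Ω) {g : L2 Ω (Grad m)}
    (h : ((0 : L2 Ω ℂ), g) ∈ H10 Ω) : g = 0 := by
  have hj : ∀ j : Fin (m + 1), ∀ᵐ x ∂(volume : Measure (Space m)), x ∈ Ω → g x j = 0 := by
    intro j
    refine hΩ.ae_eq_zero_of_integral_contDiff_smul_eq_zero ?_ fun ψ h1 h2 h3 => ?_
    · have hg : LocallyIntegrable (fun x => g x) (volume.restrict Ω) :=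
        (Lp.memLp g).locallyIntegrable (by norm_num)
      have hg' : LocallyIntegrableOn (fun x => g x) Ω volume :=
        locallyIntegrableOn_of_locallyIntegrable_restrict hg
      intro x hx
      exact (hg' x hx).imp fun t ht => ⟨ht.1, (EuclideanSpace.proj (𝕜 := ℂ) j).integrable_comp ht.2⟩
    · rw [← setIntegral_eq_integral_of_forall_compl_eq_zero (s := Ω) fun x hx => by
        rw [image_eq_zero_of_notMem_tsupport fun h => hx (h3 h), zero_smul],
        H10_weak_gradient h h1 h2 h3 j, neg_eq_zero]
      rw [← integral_zero (Space m) ℂ (μ := volume.restrict Ω)]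
      refine integral_congr_ae ?_
      filter_upwards [Lp.coeFn_zero ℂ 2 ((volume : Measure (Space m)).restrict Ω)] with x hx
      rw [hx]; simp
  refine (Lp.eq_zero_iff_ae_eq_zero).2 ((ae_restrict_iff' hΩ.measurableSet).2 ?_)
  filter_upwards [ae_all_iff.2 hj] with x hx hxΩ
  ext j
  exact hx j hxΩ

/-! ### The operator associated with the form -/

/-- The weighted sesquilinear form `∫_Ω w u · v̄ dx`. For `w = b` and scalar functions it is the
scalar product of the weighted space; for `w = a` and gradients it is the energy form. -/
def weighted {m : ℕ} (Ω : Set (Space m)) {F : Type} [NormedAddCommGroup F] [InnerProductSpace ℂ F]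
    (w : Space m → ℝ) (u v : L2 Ω F) : ℂ :=
  ∫ x in Ω, (w x : ℂ) * inner ℂ (v x) (u x)

theorem integrable_weighted {m : ℕ} (Ω : Set (Space m)) {F : Type} [NormedAddCommGroup F]
    [InnerProductSpace ℂ F] {w : Space m → ℝ} (hw : IsCoeff w) (u v : L2 Ω F) :
    Integrable (fun x => (w x : ℂ) * inner ℂ (v x) (u x)) (volume.restrict Ω) := by
  obtain ⟨hm, C, hC⟩ := hw
  refine (L2.integrable_inner (𝕜 := ℂ) v u).bdd_mul
    (Complex.measurable_ofReal.comp hm).aestronglyMeasurable (c := C) ?_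
  exact Eventually.of_forall fun x => by simpa using hC x

theorem weighted_add {m : ℕ} (Ω : Set (Space m)) {F : Type} [NormedAddCommGroup F]
    [InnerProductSpace ℂ F] {w : Space m → ℝ} (hw : IsCoeff w) (u₁ u₂ v : L2 Ω F) :
    weighted Ω w (u₁ + u₂) v = weighted Ω w u₁ v + weighted Ω w u₂ v := by
  unfold weighted
  rw [← integral_add (integrable_weighted Ω hw u₁ v) (integrable_weighted Ω hw u₂ v)]
  refine integral_congr_ae ?_
  filter_upwards [Lp.coeFn_add u₁ u₂] with x hx
  rw [hx, Pi.add_apply, inner_add_right, mul_add]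

theorem weighted_smul {m : ℕ} (Ω : Set (Space m)) {F : Type} [NormedAddCommGroup F]
    [InnerProductSpace ℂ F] (w : Space m → ℝ) (c : ℂ) (u v : L2 Ω F) :
    weighted Ω w (c • u) v = c * weighted Ω w u v := by
  unfold weighted
  rw [← integral_const_mul]
  refine integral_congr_ae ?_
  filter_upwards [Lp.coeFn_smul c u] with x hx
  rw [hx, Pi.smul_apply, inner_smul_right]
  ring

/-- The graph of `-(1/b) div (a ∇)` with Dirichlet conditions: all `(u, f)` with `u ∈ H¹₀(Ω)` and
`∫_Ω a ∇u · ∇v̄ dx = ∫_Ω b f v̄ dx` for every `v ∈ H¹₀(Ω)`. -/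
def operatorGraph {m : ℕ} (Ω : Set (Space m)) {a b : Space m → ℝ} (ha : IsCoeff a)
    (hb : IsCoeff b) : Submodule ℂ (L2 Ω ℂ × L2 Ω ℂ) where
  carrier := {p | ∃ g : L2 Ω (Grad m), (p.1, g) ∈ H10 Ω ∧
    ∀ (v : L2 Ω ℂ) (h : L2 Ω (Grad m)), (v, h) ∈ H10 Ω →
      weighted Ω a g h = weighted Ω b p.2 v}
  zero_mem' := by
    refine ⟨0, (H10 Ω).zero_mem, fun v h _ => ?_⟩
    have h1 := weighted_smul Ω a 0 (0 : L2 Ω (Grad m)) h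
    have h2 := weighted_smul Ω b 0 (0 : L2 Ω ℂ) v
    simp only [smul_zero, zero_mul] at h1 h2
    rw [h1, Prod.snd_zero, h2]
  add_mem' := by
    rintro p p' ⟨g, hg, H⟩ ⟨g', hg', H'⟩
    refine ⟨g + g', (H10 Ω).add_mem hg hg', fun v h hv => ?_⟩
    rw [weighted_add Ω ha, Prod.snd_add, weighted_add Ω hb, H v h hv, H' v h hv]
  smul_mem' := by
    rintro c p ⟨g, hg, H⟩
    refine ⟨c • g, (H10 Ω).smul_mem c hg, fun v h hv => ?_⟩
    rw [weighted_smul, Prod.smul_snd, weighted_smul, H v h hv]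

/-- The relation defining the operator is the graph of a function. -/
theorem operatorGraph_snd_eq_zero {m : ℕ} {Ω : Set (Space m)} (hΩ : IsOpen Ω)
    {a b : Space m → ℝ} (ha : IsCoeff a) (hb : IsCoeff b) (hb0 : ∀ x, b x ≠ 0)
    (p : L2 Ω ℂ × L2 Ω ℂ) (hp : p ∈ operatorGraph Ω ha hb) (h0 : p.1 = 0) : p.2 = 0 := by
  obtain ⟨u, f⟩ := p
  obtain ⟨g, hg, H⟩ := hp
  simp only at h0 hg H ⊢
  subst h0
  obtain rfl := H10_snd_eq_zero hΩ hg
  have hw : ∀ h : L2 Ω (Grad m), weighted Ω a 0 h = 0 := fun h => by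
    simpa using weighted_smul Ω a 0 (0 : L2 Ω (Grad m)) h
  have hae : ∀ᵐ x ∂(volume : Measure (Space m)), x ∈ Ω → b x • f x = 0 := by
    refine hΩ.ae_eq_zero_of_integral_contDiff_smul_eq_zero ?_ fun ψ h1 h2 h3 => ?_
    · refine locallyIntegrableOn_of_locallyIntegrable_restrict ?_
      refine MemLp.locallyIntegrable (p := 2) ?_ (by norm_num)
      obtain ⟨hm, C, hC⟩ := hb
      refine (Lp.memLp f).of_le_mul (c := C) (hm.aestronglyMeasurable.smul
        (Lp.aestronglyMeasurable f)) (Eventually.of_forall fun x => ?_)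
      rw [norm_smul]
      exact mul_le_mul_of_nonneg_right (hC x) (norm_nonneg _)
    · have hφ : ContDiff ℝ ∞ fun x => (ψ x : ℂ) := Complex.ofRealCLM.contDiff.comp h1
      have hφc : HasCompactSupport fun x => (ψ x : ℂ) :=
        h2.comp_left (g := fun t : ℝ => (t : ℂ)) (by simp)
      have hφs : tsupport (fun x => (ψ x : ℂ)) ⊆ Ω := by
        refine (closure_mono fun x hx => ?_).trans h3
        simpa using hx
      have hv : MemLp (fun x => (ψ x : ℂ)) 2 ((volume : Measure (Space m)).restrict Ω) :=
        hφ.continuous.memLp_of_hasCompactSupport hφc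
      have hh : MemLp (classicalGrad fun x => (ψ x : ℂ)) 2
          ((volume : Measure (Space m)).restrict Ω) := by
        refine Continuous.memLp_of_hasCompactSupport ?_ ?_
        · refine (PiLp.continuous_toLp 2 _).comp (continuous_pi fun i => ?_)
          exact (hφ.continuous_fderiv (by simp)).clm_apply continuous_const
        · refine (hφc.fderiv (𝕜 := ℝ)).comp_left (g := fun L : Space m →L[ℝ] ℂ =>
            (WithLp.toLp 2 fun j => L (EuclideanSpace.single j 1) : Grad m)) ?_
          ext j; simp
      have hmem : (hv.toLp, hh.toLp) ∈ H10 Ω :=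
        Submodule.le_topologicalClosure _ (Submodule.subset_span
          ⟨fun x => (ψ x : ℂ), ⟨hφ, hφc, hφs⟩, hv.coeFn_toLp, hh.coeFn_toLp⟩)
      have := H _ _ hmem
      rw [hw] at this
      rw [← setIntegral_eq_integral_of_forall_compl_eq_zero (s := Ω) fun x hx => by
        rw [image_eq_zero_of_notMem_tsupport fun h => hx (h3 h), zero_smul]]
      rw [this]
      refine integral_congr_ae ?_
      filter_upwards [hv.coeFn_toLp] with x hx
      rw [hx]
      simp only [RCLike.inner_apply, Complex.conj_ofReal, Complex.real_smul]
      ring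
  refine (Lp.eq_zero_iff_ae_eq_zero).2 ((ae_restrict_iff' hΩ.measurableSet).2 ?_)
  filter_upwards [hae] with x hx hxΩ
  exact (smul_eq_zero.1 (hx hxΩ)).resolve_left (hb0 x)

/-- The operator `-(1/b) div (a ∇)` with Dirichlet conditions, as an unbounded operator on the space
of functions of `L²(Ω)` (whose scalar product is the one weighted by `b`). For open `Ω` and nonvanishing `b` its graph is the
relation above. -/
def ellipticOperator {m : ℕ} (Ω : Set (Space m)) {a b : Space m → ℝ} (ha : IsCoeff a)
    (hb : IsCoeff b) : L2 Ω ℂ →ₗ.[ℂ] L2 Ω ℂ :=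
  (operatorGraph Ω ha hb).toLinearPMap

/-- The operator `𝒜^ε` for the values `d, α, β` of the parameters at `ε`. -/
def shellOperator {m : ℕ} (Ω : Set (Space m)) (R ε d α β : ℝ) : L2 Ω ℂ →ₗ.[ℂ] L2 Ω ℂ :=
  ellipticOperator Ω (isCoeff_stiffness Ω R ε d α) (isCoeff_density Ω R ε d β)

/-! ### Eigenvalues -/

/-- The eigenspace `{u ∈ dom A : A u = μ u}` of an unbounded operator. -/
def eigenspace {H : Type} [AddCommGroup H] [Module ℂ H] (A : H →ₗ.[ℂ] H) (μ : ℂ) :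
    Submodule ℂ H :=
  A.graph.comap (LinearMap.id.prod (μ • LinearMap.id))

/-- `l` lists the eigenvalues of `A` in ascending order, repeated according to multiplicity: every
complex number occurs in `l` exactly as many times as the dimension of its eigenspace. -/
def IsEigenvalueSequence {H : Type} [AddCommGroup H] [Module ℂ H] (A : H →ₗ.[ℂ] H)
    (l : ℕ → ℝ) : Prop :=
  Monotone l ∧ ∀ μ : ℂ,
    {k : ℕ | (l k : ℂ) = μ}.encard = Cardinal.toENat (Module.rank ℂ (eigenspace A μ))

end DoubleContrast

end

/-!
The bound holds because a soft shell almost decouples the ball inside it from the rest of `Ω`. Around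
each admissible lattice point take the function that is `1` on the ball and drops linearly to `0`
across the shell. Its energy is at most `α d⁻²` times the volume of the shell, hence at most
`α n κ (R ε)^(n-1) / d`, and its mass is at least `β κ (R ε - d)^n`, where `n = m + 1` and `κ` is the
volume of the unit ball. So its Rayleigh quotient is at most `α n / (R d ε β)` times a factor that
tends to `1` as `d / ε → 0`. Since `0` is interior to `Ω`, the number of admissible points grows beyond
any bound, and since `R < 1 / 2` the supports are disjoint; by the min-max principle each single
eigenvalue is eventually below any number larger than `q`. The transition across the shell is smoothed
with slope at most `(1 + δ) / d` (`exists_isStep`), so that genuine test functions are used, and `δ` is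
arbitrary.

The min-max principle and the existence of the sequence of eigenvalues come from the spectral theorem
for a compact operator. The space `H¹₀(Ω)` with the scalar product `∫ a ∇u · ∇v̄ + ∫ b u v̄` is the
Hilbert space `energySpace`; on it `K u = √b u` is a compact injective map to `L²(Ω)`, and `u` is an
eigenfunction for `μ` exactly when `⟪v, u⟫ = (1 + μ) ⟪K v, K u⟫` for all `v`
(`eigenspace_ellipticOperator`). The operator `K† K` has a Hilbert basis of eigenvectors, which gives
`exists_formEigenvalue_sequence` and `formEigenvalue_le_of_orthogonal`.

Compactness of `K` is Rellich's theorem, `isCompactOperator_H10_fst`: averaging over a grid of cubes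
of side `h` has finite rank and, by the estimate of translates `lintegral_translate_sub_le`, differs
from the identity by at most a multiple of `h ‖∇u‖`.
-/

noncomputable section

namespace DoubleContrast

/-! ### Two forms on a Hilbert space, one of them compact -/

theorem inner_self_eq_ofReal {E : Type*} [NormedAddCommGroup E] [InnerProductSpace ℂ E] (x : E) :
    inner ℂ x x = ((‖x‖ ^ 2 : ℝ) : ℂ) := by
  rw [inner_self_eq_norm_sq_to_K]
  push_cast
  rfl

/-- A function with finite sublevel sets on an infinite type can be listed in ascending order. -/
theorem exists_equiv_nat_monotone {ι : Type} [Infinite ι] (f : ι → ℝ)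
    (hf : ∀ c, {i | f i ≤ c}.Finite) : ∃ e : ℕ ≃ ι, Monotone (f ∘ e) := by
  have hcount : Countable ι := by
    rw [← Set.countable_univ_iff]
    refine (Set.countable_iUnion fun n : ℕ => (hf n).countable).mono fun i _ => ?_
    exact Set.mem_iUnion.2 (exists_nat_ge (f i))
  obtain ⟨g, hg⟩ := exists_injective_nat ι
  let k : ι → ℝ ×ₗ ℕ := fun i => toLex (f i, g i)
  have hk : Function.Injective k := fun i j h => hg (congrArg Prod.snd (toLex.injective h))
  have hmono : ∀ {i j}, k i ≤ k j → f i ≤ f j := fun {i j} h => by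
    rcases (Prod.Lex.toLex_le_toLex).1 h with h | h
    · exact h.le
    · exact h.1.le
  have hfin : ∀ i, {j | k j < k i}.Finite := fun i =>
    (hf (f i)).subset fun j hj => hmono (le_of_lt hj)
  -- the number of predecessors, strictly increasing along the lexicographic order
  let rk : ι → ℕ := fun i => {j | k j < k i}.ncard
  have hrk : ∀ {i j}, k i < k j → rk i < rk j := fun {i j} h =>
    Set.ncard_lt_ncard ⟨fun x hx => lt_trans hx h, fun hsub => lt_irrefl (k i) (hsub h)⟩ (hfin j)
  have hinj : Function.Injective rk := fun i j h => by
    rcases lt_trichotomy (k i) (k j) with h' | h' | h'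
    · exact absurd h (hrk h').ne
    · exact hk h'
    · exact absurd h (hrk h').ne'
  have hrange : (Set.range rk).Infinite := Set.infinite_range_of_injective hinj
  have := hrange.to_subtype
  classical
  refine ⟨(Nat.Subtype.orderIsoOfNat (Set.range rk)).toEquiv.trans
    (Equiv.ofInjective rk hinj).symm, fun m n hmn => ?_⟩
  have h1 := (Nat.Subtype.orderIsoOfNat (Set.range rk)).monotone hmn
  set x := Nat.Subtype.orderIsoOfNat (Set.range rk) m
  set y := Nat.Subtype.orderIsoOfNat (Set.range rk) n
  obtain ⟨i, hi⟩ := (Equiv.ofInjective rk hinj).surjective x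
  obtain ⟨j, hj⟩ := (Equiv.ofInjective rk hinj).surjective y
  change f ((Equiv.ofInjective rk hinj).symm x) ≤ f ((Equiv.ofInjective rk hinj).symm y)
  rw [← hi, ← hj, Equiv.symm_apply_apply, Equiv.symm_apply_apply]
  rw [← hi, ← hj] at h1
  have h2 : rk i ≤ rk j := h1
  exact hmono (le_of_not_gt fun h => absurd h2 (hrk h).not_ge)

section TwoForms

variable {V H : Type} [NormedAddCommGroup V] [InnerProductSpace ℂ V]
  [NormedAddCommGroup H] [InnerProductSpace ℂ H]

/-- For `V` with the scalar product `a + b` and `b = ⟪K ·, K ·⟫`, the vectors `p` with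
`a(p', p) = μ b(p', p)` for all `p'`. -/
def formEigenspace (K : V →L[ℂ] H) (μ : ℂ) : Submodule ℂ V where
  carrier := {p | ∀ p', inner ℂ p' p = (1 + μ) * inner ℂ (K p') (K p)}
  zero_mem' := fun p' => by simp
  add_mem' := fun {p q} hp hq p' => by
    rw [inner_add_right, map_add, inner_add_right, hp p', hq p', mul_add]
  smul_mem' := fun c p hp p' => by
    rw [inner_smul_right, map_smul, inner_smul_right, hp p']; ring

/-- The eigenvalue belonging to a vector on which `‖p‖² = (1 + λ) ‖K p‖²`. -/
def formEigenvalue (K : V →L[ℂ] H) (p : V) : ℝ := 1 / ‖K p‖ ^ 2 - 1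

theorem norm_sq_basis_pos {K : V →L[ℂ] H} {ι : Type} {b : HilbertBasis ι ℂ V}
    (hinj : Function.Injective K) (i : ι) : 0 < ‖K (b i)‖ ^ 2 := by
  have : K (b i) ≠ 0 := fun h => b.orthonormal.ne_zero i (hinj (by rw [h, map_zero]))
  positivity

variable {K : V →L[ℂ] H} {ι : Type} {b : HilbertBasis ι ℂ V}

/-- Compactness of `K` makes the eigenvalues tend to infinity: the vectors `K (b i)` with eigenvalue
at most `c` are uniformly separated. -/
theorem finite_formEigenvalue_le (hK : IsCompactOperator K) (hinj : Function.Injective K)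
    (hb : ∀ i p, inner ℂ (K p) (K (b i)) = ((‖K (b i)‖ ^ 2 : ℝ) : ℂ) * inner ℂ p (b i)) (c : ℝ) :
    {i | formEigenvalue K (b i) ≤ c}.Finite := by
  by_contra hinf
  have hinf : {i | formEigenvalue K (b i) ≤ c}.Infinite := hinf
  obtain ⟨s, hs, hsc⟩ : ∃ s : ℕ → ι, Function.Injective s ∧
      ∀ n, formEigenvalue K (b (s n)) ≤ c :=
    ⟨fun n => hinf.natEmbedding _ n, fun m n h => (hinf.natEmbedding _).injective (Subtype.ext h),
      fun n => (hinf.natEmbedding _ n).2⟩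
  have hlow : ∀ n, 1 / (|c| + 1) ≤ ‖K (b (s n))‖ ^ 2 := fun n => by
    have h1 := hsc n
    have h2 := norm_sq_basis_pos (b := b) hinj (s n)
    unfold formEigenvalue at h1
    rw [div_le_iff₀ (by positivity)]
    have h3 : 1 / ‖K (b (s n))‖ ^ 2 ≤ |c| + 1 := by linarith [le_abs_self c]
    rw [div_le_iff₀ h2] at h3
    linarith
  have hsep : ∀ m n, m ≠ n → 1 / (|c| + 1) ≤ ‖K (b (s m)) - K (b (s n))‖ ^ 2 := by
    intro m n hmn
    have h0 : inner ℂ (K (b (s m))) (K (b (s n))) = 0 := by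
      rw [hb, b.orthonormal.2 (hs.ne hmn), mul_zero]
    have h1 := norm_sub_sq (𝕜 := ℂ) (K (b (s m))) (K (b (s n)))
    rw [h0] at h1
    simp only [map_zero, mul_zero, sub_zero] at h1
    rw [h1]
    have := hlow m
    have := sq_nonneg ‖K (b (s n))‖
    linarith
  obtain ⟨C, hC, hsub⟩ := hK.image_closedBall_subset_compact (f := (K : V →ₗ[ℂ] H)) 1
  have hmem : ∀ n, K (b (s n)) ∈ C := fun n => hsub ⟨b (s n), by
    simp [b.orthonormal.1], rfl⟩
  obtain ⟨x, -, φ, hφ, hlim⟩ := hC.tendsto_subseq hmem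
  have hcau := hlim.cauchySeq
  have hpos : 0 < 1 / (|c| + 1) := by positivity
  obtain ⟨N, hN⟩ := Metric.cauchySeq_iff.1 hcau (Real.sqrt (1 / (|c| + 1))) (Real.sqrt_pos.2 hpos)
  have h1 := hN (N + 1) (by simp) N le_rfl
  rw [dist_eq_norm] at h1
  have h2 := hsep (φ (N + 1)) (φ N) (hφ.injective.ne (by simp))
  have h3 := (Real.lt_sqrt (norm_nonneg _)).1 h1
  simp only [Function.comp_apply] at h3
  linarith

/-- A basis in which the form `⟪K ·, K ·⟫` is diagonal, as expressed by `hb`, consists of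
eigenvectors. -/
theorem basis_mem_formEigenspace (hinj : Function.Injective K)
    (hb : ∀ i p, inner ℂ (K p) (K (b i)) = ((‖K (b i)‖ ^ 2 : ℝ) : ℂ) * inner ℂ p (b i)) (i : ι) :
    b i ∈ formEigenspace K (formEigenvalue K (b i) : ℂ) := by
  intro p'
  have h2 := (norm_sq_basis_pos (b := b) hinj i).ne'
  rw [hb, ← mul_assoc]
  have : (1 + (formEigenvalue K (b i) : ℂ)) * ((‖K (b i)‖ ^ 2 : ℝ) : ℂ) = 1 := by
    norm_cast
    unfold formEigenvalue
    rw [add_sub_cancel, one_div_mul_cancel h2]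
  rw [this, one_mul]

theorem inner_basis_eq_zero (hinj : Function.Injective K)
    (hb : ∀ i p, inner ℂ (K p) (K (b i)) = ((‖K (b i)‖ ^ 2 : ℝ) : ℂ) * inner ℂ p (b i)) {μ : ℂ}
    {p : V} (hp : p ∈ formEigenspace K μ) {i : ι} (hi : (formEigenvalue K (b i) : ℂ) ≠ μ) :
    inner ℂ (b i) p = 0 := by
  have h1 : inner ℂ p (b i) = (1 + (formEigenvalue K (b i) : ℂ)) * inner ℂ (K p) (K (b i)) :=
    basis_mem_formEigenspace hinj hb i p
  have h2 : inner ℂ (b i) p = (1 + μ) * inner ℂ (K (b i)) (K p) := hp (b i)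
  have h3 := congrArg (starRingEnd ℂ) h1
  rw [map_mul, inner_conj_symm, inner_conj_symm, map_add, map_one, Complex.conj_ofReal] at h3
  have h4 : ((formEigenvalue K (b i) : ℂ) - μ) * inner ℂ (K (b i)) (K p) = 0 := by
    linear_combination h2 - h3
  have h5 := (mul_eq_zero.1 h4).resolve_left (sub_ne_zero.2 hi)
  rw [h2, h5, mul_zero]

theorem formEigenspace_eq_span (hK : IsCompactOperator K) (hinj : Function.Injective K)
    (hb : ∀ i p, inner ℂ (K p) (K (b i)) = ((‖K (b i)‖ ^ 2 : ℝ) : ℂ) * inner ℂ p (b i)) (μ : ℂ) :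
    formEigenspace K μ = Submodule.span ℂ (b '' {i | (formEigenvalue K (b i) : ℂ) = μ}) := by
  have hfin : {i | (formEigenvalue K (b i) : ℂ) = μ}.Finite :=
    (finite_formEigenvalue_le hK hinj hb μ.re).subset fun i hi => by
      have hi : (formEigenvalue K (b i) : ℂ) = μ := hi
      simp [← hi]
  refine le_antisymm (fun p hp => ?_) (Submodule.span_le.2 ?_)
  · have h1 := b.hasSum_repr p
    have h2 : HasSum (fun i => b.repr p i • b i) (∑ i ∈ hfin.toFinset, b.repr p i • b i) := by
      refine hasSum_sum_of_ne_finset_zero fun i hi => ?_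
      rw [b.repr_apply_apply, inner_basis_eq_zero hinj hb hp (fun h => hi (by simpa using h)),
        zero_smul]
    rw [h1.unique h2]
    refine Submodule.sum_mem _ fun i hi => Submodule.smul_mem _ _ (Submodule.subset_span ?_)
    exact ⟨i, by simpa using hi, rfl⟩
  · rintro _ ⟨i, hi, rfl⟩
    have hi : (formEigenvalue K (b i) : ℂ) = μ := hi
    rw [← hi]
    exact basis_mem_formEigenspace hinj hb i

theorem toENat_rank_formEigenspace (hK : IsCompactOperator K) (hinj : Function.Injective K)
    (hb : ∀ i p, inner ℂ (K p) (K (b i)) = ((‖K (b i)‖ ^ 2 : ℝ) : ℂ) * inner ℂ p (b i)) (μ : ℂ) :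
    Cardinal.toENat (Module.rank ℂ (formEigenspace K μ)) =
      {i | (formEigenvalue K (b i) : ℂ) = μ}.encard := by
  rw [formEigenspace_eq_span hK hinj hb, rank_span_set, Set.encard, ENat.card,
    Cardinal.mk_image_eq b.orthonormal.linearIndependent.injective]
  exact LinearIndepOn.id_image (b.orthonormal.linearIndependent.linearIndepOn _)

variable [CompleteSpace V] [CompleteSpace H]

/-- The form `⟪K ·, K ·⟫` is diagonal in some Hilbert basis, by the spectral theorem for the compact
operator `K† K`. -/
theorem exists_hilbertBasis_diagonal {K : V →L[ℂ] H} (hK : IsCompactOperator K)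
    (hinj : Function.Injective K) :
    ∃ (ι : Type) (b : HilbertBasis ι ℂ V), ∀ i p,
      inner ℂ (K p) (K (b i)) = ((‖K (b i)‖ ^ 2 : ℝ) : ℂ) * inner ℂ p (b i) := by
  set T : V →L[ℂ] V := (ContinuousLinearMap.adjoint K).comp K with hT
  have hTK : ∀ x y, inner ℂ x (T y) = inner ℂ (K x) (K y) := fun x y => by
    rw [hT, ContinuousLinearMap.comp_apply, ContinuousLinearMap.adjoint_inner_right]
  have hKT : ∀ x y, inner ℂ (T x) y = inner ℂ (K x) (K y) := fun x y => by
    rw [hT, ContinuousLinearMap.comp_apply, ContinuousLinearMap.adjoint_inner_left]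
  have hsymm : (T : V →ₗ[ℂ] V).IsSymmetric := fun x y => by
    rw [ContinuousLinearMap.coe_coe, hKT, hTK]
  have hcomp : IsCompactOperator T := hK.clm_comp (ContinuousLinearMap.adjoint K)
  have hker : Module.End.eigenspace (T : V →ₗ[ℂ] V) 0 = ⊥ := by
    refine (Submodule.eq_bot_iff _).2 fun x hx => ?_
    rw [Module.End.mem_eigenspace_iff, zero_smul, ContinuousLinearMap.coe_coe] at hx
    have h0 := hTK x x
    rw [hx, inner_zero_right] at h0
    exact hinj (by rw [inner_self_eq_zero.1 h0.symm, map_zero])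
  have hfin : ∀ μ, FiniteDimensional ℂ (Module.End.eigenspace (T : V →ₗ[ℂ] V) μ) := by
    intro μ
    by_cases hμ : μ = 0
    · rw [hμ, hker]; infer_instance
    · exact ContinuousLinearMap.finite_dimensional_eigenspace hcomp μ hμ
  let v : (Σ μ : ℂ, Fin (Module.finrank ℂ (Module.End.eigenspace (T : V →ₗ[ℂ] V) μ))) → V :=
    fun a => (stdOrthonormalBasis ℂ (Module.End.eigenspace (T : V →ₗ[ℂ] V) a.1) a.2 : V)
  have hv : Orthonormal ℂ v :=
    hsymm.orthogonalFamily_eigenspaces.orthonormal_sigma_orthonormal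
      fun μ => (stdOrthonormalBasis ℂ (Module.End.eigenspace (T : V →ₗ[ℂ] V) μ)).orthonormal
  have hspan : (Submodule.span ℂ (Set.range v))ᗮ = ⊥ := by
    refine eq_bot_iff.2 ((Submodule.orthogonal_le (iSup_le fun μ => ?_)).trans
      (ContinuousLinearMap.orthogonalComplement_iSup_eigenspaces_eq_bot hcomp hsymm).le)
    intro x hx
    have h1 := (stdOrthonormalBasis ℂ (Module.End.eigenspace (T : V →ₗ[ℂ] V) μ)).sum_repr ⟨x, hx⟩
    have h2 := congrArg (Submodule.subtype _) h1
    rw [map_sum] at h2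
    simp only [Submodule.subtype_apply] at h2
    rw [← h2]
    refine Submodule.sum_mem _ fun j _ => ?_
    exact Submodule.smul_mem _ _ (Submodule.subset_span ⟨⟨μ, j⟩, rfl⟩)
  refine ⟨_, HilbertBasis.mkOfOrthogonalEqBot hv hspan, fun i p => ?_⟩
  rw [HilbertBasis.coe_mkOfOrthogonalEqBot]
  have hev : T (v i) = i.1 • v i := Module.End.mem_eigenspace_iff.1
    (stdOrthonormalBasis ℂ (Module.End.eigenspace (T : V →ₗ[ℂ] V) i.1) i.2).2
  have hone : inner ℂ (v i) (v i) = (1 : ℂ) := by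
    rw [inner_self_eq_norm_sq_to_K, hv.1 i]; simp
  have hμ : ((‖K (v i)‖ ^ 2 : ℝ) : ℂ) = i.1 := by
    have := hTK (v i) (v i)
    rw [hev, inner_smul_right, hone, inner_self_eq_ofReal, mul_one] at this
    exact this.symm
  rw [hμ, ← hTK, hev, inner_smul_right]

/-- On an infinite-dimensional space the eigenvalues, counted with multiplicity, form an ascending
sequence. -/
theorem exists_formEigenvalue_sequence (hK : IsCompactOperator K) (hinj : Function.Injective K)
    (hV : ¬ FiniteDimensional ℂ V) :
    ∃ l : ℕ → ℝ, Monotone l ∧ ∀ μ : ℂ, {k : ℕ | (l k : ℂ) = μ}.encard =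
      Cardinal.toENat (Module.rank ℂ (formEigenspace K μ)) := by
  obtain ⟨ι, b, hb⟩ := exists_hilbertBasis_diagonal hK hinj
  have hι : Infinite ι := by
    by_contra h
    rw [not_infinite_iff_finite] at h
    have := Fintype.ofFinite ι
    exact hV (Module.Finite.of_basis b.toOrthonormalBasis.toBasis)
  obtain ⟨e, he⟩ := exists_equiv_nat_monotone _ (finite_formEigenvalue_le hK hinj hb)
  refine ⟨_, he, fun μ => ?_⟩
  rw [toENat_rank_formEigenspace hK hinj hb]
  exact Set.encard_preimage_of_bijective e.bijective {i | (formEigenvalue K (b i) : ℂ) = μ}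

/-- The upper half of the min-max principle: `k + 1` nonzero vectors orthogonal for both forms, each
with Rayleigh quotient at most `c`, force the eigenvalue with index `k` to be at most `c`. -/
theorem formEigenvalue_le_of_orthogonal (hK : IsCompactOperator K) (hinj : Function.Injective K)
    {l : ℕ → ℝ} (hl : Monotone l) (hlK : ∀ μ : ℂ, {k : ℕ | (l k : ℂ) = μ}.encard =
      Cardinal.toENat (Module.rank ℂ (formEigenspace K μ)))
    {k : ℕ} {c : ℝ} (p : Fin (k + 1) → V) (hp0 : ∀ i, p i ≠ 0)
    (hp : Pairwise fun i j => inner ℂ (p i) (p j) = 0)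
    (hKp : Pairwise fun i j => inner ℂ (K (p i)) (K (p j)) = 0)
    (hc : ∀ i, ‖p i‖ ^ 2 ≤ (1 + c) * ‖K (p i)‖ ^ 2) : l k ≤ c := by
  obtain ⟨ι, b, hb⟩ := exists_hilbertBasis_diagonal hK hinj
  -- the sequence `l` lists the eigenvalues of the basis vectors
  obtain ⟨e, he⟩ : ∃ e : ℕ ≃ ι, ∀ j, l j = formEigenvalue K (b (e j)) := by
    have hfib : ∀ x : ℝ, Nonempty ({j // l j = x} ≃ {i // formEigenvalue K (b i) = x}) := by
      intro x
      have h1 : {j | l j = x}.encard = {i | formEigenvalue K (b i) = x}.encard := by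
        have := (hlK x).trans (toENat_rank_formEigenspace hK hinj hb x)
        simpa only [Complex.ofReal_inj] using this
      have h2 : {i | formEigenvalue K (b i) = x}.Finite :=
        (finite_formEigenvalue_le hK hinj hb x).subset fun i hi => le_of_eq hi
      have h3 : {j | l j = x}.Finite := by
        rw [← Set.encard_lt_top_iff, h1, Set.encard_lt_top_iff]; exact h2
      have : Finite {i // formEigenvalue K (b i) = x} := h2.to_subtype
      have : Finite {j // l j = x} := h3.to_subtype
      refine (Finite.card_eq).1 ?_
      exact congrArg ENat.toNat h1
    let g := fun x => (hfib x).some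
    refine ⟨(Equiv.sigmaFiberEquiv l).symm.trans ((Equiv.sigmaCongrRight g).trans
      (Equiv.sigmaFiberEquiv fun i => formEigenvalue K (b i))), fun j => ?_⟩
    exact ((g (l j)) ⟨j, rfl⟩).2.symm
  -- a combination orthogonal to the first `k` eigenvectors
  let M : (Fin (k + 1) → ℂ) →ₗ[ℂ] (Fin k → ℂ) :=
    LinearMap.pi fun j => ∑ i, (inner ℂ (b (e j)) (p i) : ℂ) • LinearMap.proj i
  obtain ⟨z, hz, hz0⟩ := (LinearMap.ker M).ne_bot_iff.1
    (LinearMap.ker_ne_bot_of_finrank_lt (f := M) (by simp))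
  set w : V := ∑ i, z i • p i with hw
  have horth : ∀ j : Fin k, inner ℂ (b (e j)) w = 0 := fun j => by
    have h1 := congrFun (LinearMap.mem_ker.1 hz) j
    simp only [M, LinearMap.pi_apply, LinearMap.sum_apply, LinearMap.smul_apply,
      LinearMap.proj_apply, smul_eq_mul, Pi.zero_apply] at h1
    rw [hw, inner_sum, ← h1]
    exact Finset.sum_congr rfl fun i _ => by rw [inner_smul_right, mul_comm]
  have hnw : ‖w‖ ^ 2 = ∑ i, ‖z i‖ ^ 2 * ‖p i‖ ^ 2 := by
    have h1 : (inner ℂ w w : ℂ) = ∑ i, (‖z i‖ ^ 2 * ‖p i‖ ^ 2 : ℝ) := by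
      rw [hw, sum_inner, Complex.ofReal_sum]
      refine (Finset.sum_congr rfl fun i _ => ?_)
      rw [inner_sum, Finset.sum_eq_single i]
      · rw [inner_smul_left, inner_smul_right, inner_self_eq_ofReal, ← mul_assoc,
          Complex.conj_mul']
        push_cast; rfl
      · intro j _ hji
        rw [inner_smul_left, inner_smul_right, hp hji.symm, mul_zero, mul_zero]
      · simp
    rw [inner_self_eq_ofReal] at h1
    exact_mod_cast h1
  have hnK : ‖K w‖ ^ 2 = ∑ i, ‖z i‖ ^ 2 * ‖K (p i)‖ ^ 2 := by
    have h1 : (inner ℂ (K w) (K w) : ℂ) = ∑ i, (‖z i‖ ^ 2 * ‖K (p i)‖ ^ 2 : ℝ) := by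
      rw [hw, map_sum, sum_inner, Complex.ofReal_sum]
      refine (Finset.sum_congr rfl fun i _ => ?_)
      rw [inner_sum, Finset.sum_eq_single i]
      · rw [map_smul, inner_smul_left, inner_smul_right, inner_self_eq_ofReal, ← mul_assoc,
          Complex.conj_mul']
        push_cast; rfl
      · intro j _ hji
        rw [map_smul, map_smul, inner_smul_left, inner_smul_right, hKp hji.symm, mul_zero,
          mul_zero]
      · simp
    rw [inner_self_eq_ofReal] at h1
    exact_mod_cast h1
  have hle : ‖w‖ ^ 2 ≤ (1 + c) * ‖K w‖ ^ 2 := by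
    rw [hnw, hnK, Finset.mul_sum]
    refine Finset.sum_le_sum fun i _ => ?_
    have := mul_le_mul_of_nonneg_left (hc i) (sq_nonneg ‖z i‖)
    linarith
  have hwpos : 0 < ‖w‖ ^ 2 := by
    obtain ⟨i, hi⟩ : ∃ i, z i ≠ 0 := by
      by_contra h
      push Not at h
      exact hz0 (funext h)
    rw [hnw]
    refine Finset.sum_pos' (fun j _ => by positivity) ⟨i, Finset.mem_univ _, ?_⟩
    have := hp0 i
    positivity
  -- in the eigenbasis, `w` only sees eigenvalues that are at least `l k`
  have hge : (1 + l k) * ‖K w‖ ^ 2 ≤ ‖w‖ ^ 2 := by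
    have hre : ∀ u v : V, (inner ℂ u v * inner ℂ v u : ℂ) = ((‖inner ℂ v u‖ ^ 2 : ℝ) : ℂ) := by
      intro u v
      rw [← inner_conj_symm u v, Complex.conj_mul']; push_cast; rfl
    have h1 : HasSum (fun i => ‖inner ℂ (b i) w‖ ^ 2) (‖w‖ ^ 2) := by
      have := b.hasSum_inner_mul_inner w w
      simp only [hre] at this
      rw [inner_self_eq_ofReal] at this
      exact_mod_cast this
    have h2 : HasSum (fun i => ‖K (b i)‖ ^ 2 * ‖inner ℂ (b i) w‖ ^ 2) (‖K w‖ ^ 2) := by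
      have := b.hasSum_inner_mul_inner ((ContinuousLinearMap.adjoint K) (K w)) w
      simp only [ContinuousLinearMap.adjoint_inner_left, hb] at this
      simp only [mul_assoc, hre] at this
      rw [inner_self_eq_ofReal] at this
      exact_mod_cast this
    refine hasSum_le (fun i => ?_) (h2.mul_left (1 + l k)) h1
    obtain ⟨j, rfl⟩ := e.surjective i
    rcases lt_or_ge j k with hjk | hjk
    · have := horth ⟨j, hjk⟩
      simp only at this
      simp [this]
    · have h3 : l k ≤ formEigenvalue K (b (e j)) := he j ▸ hl hjk
      have h4 := norm_sq_basis_pos (b := b) hinj (e j)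
      have h5 : (1 + l k) * ‖K (b (e j))‖ ^ 2 ≤ 1 := by
        unfold formEigenvalue at h3
        have : 1 + l k ≤ 1 / ‖K (b (e j))‖ ^ 2 := by linarith
        rwa [le_div_iff₀ h4] at this
      nlinarith [sq_nonneg ‖inner ℂ (b (e j)) w‖]
  by_contra! hlt
  have h0 : ‖K w‖ ^ 2 = 0 := le_antisymm (by nlinarith) (sq_nonneg _)
  rw [h0] at hle
  linarith

end TwoForms

section Rellich

/-! ### Compactness of the embedding of `H¹₀(Ω)` into `L²(Ω)` -/

/-- Jensen's inequality for the square of the norm. -/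
theorem enorm_integral_sq_le {X E : Type*} [MeasurableSpace X] [NormedAddCommGroup E]
    [NormedSpace ℝ E] {μ : Measure X} [IsProbabilityMeasure μ] {f : X → E}
    (hf : AEStronglyMeasurable f μ) : ‖∫ x, f x ∂μ‖ₑ ^ 2 ≤ ∫⁻ x, ‖f x‖ₑ ^ 2 ∂μ := by
  have h1 : ‖∫ x, f x ∂μ‖ₑ ≤ eLpNorm f 2 μ :=
    (enorm_integral_le_lintegral_enorm f).trans
      (eLpNorm_one_eq_lintegral_enorm.symm.le.trans
        (eLpNorm_le_eLpNorm_of_exponent_le (by norm_num) hf))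
  have h2 := eLpNorm_nnreal_pow_eq_lintegral (f := f) (μ := μ) (p := 2) (by norm_num)
  simp only [NNReal.coe_ofNat, ENNReal.rpow_ofNat, ENNReal.coe_ofNat] at h2
  rw [← h2]
  gcongr

theorem enorm_sq_eq_lintegral {X E : Type*} [MeasurableSpace X] [NormedAddCommGroup E]
    {μ : Measure X} (f : Lp E 2 μ) : ‖f‖ₑ ^ 2 = ∫⁻ x, ‖f x‖ₑ ^ 2 ∂μ := by
  have h2 := eLpNorm_nnreal_pow_eq_lintegral (f := f) (μ := μ) (p := 2) (by norm_num)
  simp only [NNReal.coe_ofNat, ENNReal.rpow_ofNat, ENNReal.coe_ofNat] at h2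
  rw [Lp.enorm_def, h2]

variable {m : ℕ}

theorem continuous_classicalGrad {φ : Space m → ℂ} (hφ : ContDiff ℝ 1 φ) :
    Continuous (classicalGrad φ) := by
  refine (PiLp.continuous_toLp 2 _).comp (continuous_pi fun i => ?_)
  exact (hφ.continuous_fderiv (by simp)).clm_apply continuous_const

theorem norm_fderiv_apply_le (φ : Space m → ℂ) (x z : Space m) :
    ‖fderiv ℝ φ x z‖ ≤ ‖z‖ * ‖classicalGrad φ x‖ := by
  have hz : z = ∑ j, z j • (EuclideanSpace.single j 1 : Space m) := by
    ext i
    simp [Finset.sum_apply, Pi.single_apply]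
  have h1 : fderiv ℝ φ x z = ∑ j, z j • classicalGrad φ x j := by
    conv_lhs => rw [hz]
    simp only [map_sum, map_smul]
    rfl
  rw [h1, EuclideanSpace.norm_eq, EuclideanSpace.norm_eq]
  refine (norm_sum_le _ _).trans ?_
  simp only [norm_smul]
  exact Real.sum_mul_le_sqrt_mul_sqrt _ _ _

/-- A translation by `z` changes a function by at most `|z|` times the norm of its gradient. -/
theorem lintegral_translate_sub_le {φ : Space m → ℂ} (hφ : ContDiff ℝ 1 φ) (z : Space m) :
    ∫⁻ x, ‖φ (x + z) - φ x‖ₑ ^ 2 ≤ ‖z‖ₑ ^ 2 * ∫⁻ x, ‖classicalGrad φ x‖ₑ ^ 2 := by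
  have hcg := continuous_classicalGrad hφ
  have hpt : ∀ x, ‖φ (x + z) - φ x‖ₑ ^ 2 ≤
      ∫⁻ t in Ioc (0 : ℝ) 1, ‖z‖ₑ ^ 2 * ‖classicalGrad φ (x + t • z)‖ₑ ^ 2 := by
    intro x
    have hd : ∀ t ∈ Set.uIcc (0 : ℝ) 1,
        HasDerivAt (fun t : ℝ => φ (x + t • z)) (fderiv ℝ φ (x + t • z) z) t := by
      intro t _
      have h1 : HasDerivAt (fun t : ℝ => x + t • z) z t := by
        simpa using ((hasDerivAt_id t).smul_const z).const_add x
      exact ((hφ.differentiable (by simp)) _).hasFDerivAt.comp_hasDerivAt t h1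
    have hc : Continuous fun t : ℝ => fderiv ℝ φ (x + t • z) z :=
      ((hφ.continuous_fderiv (by simp)).comp
        (continuous_const.add (continuous_id.smul continuous_const))).clm_apply continuous_const
    have h2 := intervalIntegral.integral_eq_sub_of_hasDerivAt hd (hc.intervalIntegrable _ _)
    simp only [one_smul, zero_smul, add_zero] at h2
    rw [← h2, intervalIntegral.integral_of_le zero_le_one]
    have : IsProbabilityMeasure ((volume : Measure ℝ).restrict (Ioc 0 1)) :=
      ⟨by simp⟩
    refine (enorm_integral_sq_le hc.aestronglyMeasurable).trans (lintegral_mono fun t => ?_)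
    rw [← mul_pow]
    gcongr
    rw [← ofReal_norm, ← ofReal_norm z, ← ofReal_norm (classicalGrad φ _),
      ← ENNReal.ofReal_mul (norm_nonneg _)]
    exact ENNReal.ofReal_le_ofReal (norm_fderiv_apply_le φ _ z)
  refine (lintegral_mono hpt).trans ?_
  have hmeas : Measurable (Function.uncurry fun (x : Space m) (t : ℝ) =>
      ‖z‖ₑ ^ 2 * ‖classicalGrad φ (x + t • z)‖ₑ ^ 2) := by
    refine Measurable.const_mul (Measurable.pow_const ?_ 2) _
    exact (hcg.comp (continuous_fst.add (continuous_snd.smul continuous_const))).enorm.measurable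
  rw [lintegral_lintegral_swap hmeas.aemeasurable]
  have : ∀ t : ℝ, ∫⁻ x, ‖z‖ₑ ^ 2 * ‖classicalGrad φ (x + t • z)‖ₑ ^ 2 =
      ‖z‖ₑ ^ 2 * ∫⁻ x, ‖classicalGrad φ x‖ₑ ^ 2 := fun t => by
    rw [lintegral_const_mul _ (by
        exact (hcg.comp (continuous_id.add continuous_const)).enorm.measurable.pow_const 2),
      lintegral_add_right_eq_self (fun x => ‖classicalGrad φ x‖ₑ ^ 2)]
  simp only [this]
  simp

/-- The half-open cube of side `h` with index `k` in the grid of cubes. -/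
def gridCube (h : ℝ) (k : Fin (m + 1) → ℤ) : Set (Space m) := {x | ∀ j, ⌊x j / h⌋ = k j}

theorem measurableSet_gridCube (h : ℝ) (k : Fin (m + 1) → ℤ) :
    MeasurableSet (gridCube (m := m) h k) := by
  unfold gridCube
  simp only [Set.ofPred_forall]
  refine MeasurableSet.iInter fun j => ?_
  have : Measurable fun x : Space m => ⌊x j / h⌋ :=
    Int.measurable_floor.comp
      ((EuclideanSpace.proj (𝕜 := ℝ) j).continuous.measurable.div_const h)
  exact this (measurableSet_singleton (k j))

theorem volume_gridCube {h : ℝ} (hh : 0 < h) (k : Fin (m + 1) → ℤ) :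
    volume (gridCube (m := m) h k) = ENNReal.ofReal (h ^ (m + 1)) := by
  have h1 : gridCube h k = (WithLp.ofLp : Space m → (Fin (m + 1) → ℝ)) ⁻¹'
      Set.univ.pi fun j => Ico (h * k j) (h * k j + h) := by
    ext x
    simp only [gridCube, Set.mem_ofPred_eq, Set.mem_preimage, Set.mem_pi, Set.mem_univ, true_imp_iff,
      Int.floor_eq_iff, Set.mem_Ico]
    refine forall_congr' fun j => ?_
    rw [le_div_iff₀ hh, div_lt_iff₀ hh, mul_comm, add_mul, one_mul, mul_comm (k j : ℝ) h]
  rw [h1, (PiLp.volume_preserving_ofLp (Fin (m + 1))).measure_preimage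
    (MeasurableSet.univ_pi fun _ => measurableSet_Ico).nullMeasurableSet, Real.volume_pi_Ico]
  simp [← ENNReal.ofReal_pow hh.le]

theorem norm_sub_le_of_mem_gridCube {h : ℝ} (hh : 0 < h) {k : Fin (m + 1) → ℤ} {x y : Space m}
    (hx : x ∈ gridCube h k) (hy : y ∈ gridCube h k) : ‖y - x‖ ≤ √((m : ℝ) + 1) * h := by
  rw [EuclideanSpace.norm_eq, ← Real.sqrt_sq hh.le, ← Real.sqrt_mul (by positivity)]
  refine Real.sqrt_le_sqrt ?_
  calc ∑ j, ‖(y - x) j‖ ^ 2 ≤ ∑ _j : Fin (m + 1), h ^ 2 := by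
        refine Finset.sum_le_sum fun j _ => ?_
        have h1 := Int.floor_eq_iff.1 (hx j)
        have h2 := Int.floor_eq_iff.1 (hy j)
        rw [le_div_iff₀ hh, div_lt_iff₀ hh] at h1 h2
        have h3 : |(y - x) j| ≤ h := by
          rw [PiLp.sub_apply, abs_le]
          constructor <;> linarith [h1.1, h1.2, h2.1, h2.2]
        rw [Real.norm_eq_abs]
        exact pow_le_pow_left₀ (abs_nonneg _) h3 2
    _ = ((m : ℝ) + 1) * h ^ 2 := by simp

theorem mem_gridCube_floor (h : ℝ) (x : Space m) : x ∈ gridCube h fun j => ⌊x j / h⌋ :=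
  fun _ => rfl

theorem gridCube_unique {h : ℝ} {x : Space m} {k : Fin (m + 1) → ℤ} (hx : x ∈ gridCube h k) :
    k = fun j => ⌊x j / h⌋ :=
  funext fun j => (hx j).symm

/-- A bounded set meets finitely many cubes. -/
theorem finite_gridCube_meets {Ω : Set (Space m)} (hΩ : Bornology.IsBounded Ω) {h : ℝ}
    (hh : 0 < h) : {k | ∃ x ∈ Ω, x ∈ gridCube (m := m) h k}.Finite := by
  obtain ⟨M, hM⟩ := hΩ.exists_norm_le
  refine (Set.Finite.pi' fun _ : Fin (m + 1) =>
    Set.finite_Icc ⌊-M / h⌋ ⌊M / h⌋).subset ?_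
  rintro k ⟨x, hx, hk⟩ j
  rw [← hk j]
  have h1 : |x j| ≤ M := (PiLp.norm_apply_le x j).trans (hM x hx)
  constructor
  · exact Int.floor_le_floor (by gcongr; linarith [abs_le.1 h1])
  · exact Int.floor_le_floor (by gcongr; linarith [abs_le.1 h1])

/-- The deviation of a function from its mean over a cube, in terms of its translates. -/
theorem enorm_sub_average_sq_le {φ : Space m → ℂ} (hφ : Continuous φ) {h : ℝ}
    (hh : 0 < h) {k : Fin (m + 1) → ℤ} {x : Space m} (hx : x ∈ gridCube h k)
    (hint : IntegrableOn φ (gridCube h k)) :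
    ‖φ x - ((h ^ (m + 1) : ℝ) : ℂ)⁻¹ * ∫ y in gridCube h k, φ y‖ₑ ^ 2 ≤
      (ENNReal.ofReal (h ^ (m + 1)))⁻¹ *
        ∫⁻ z in Metric.closedBall (0 : Space m) (√((m : ℝ) + 1) * h), ‖φ (x + z) - φ x‖ₑ ^ 2 := by
  have hpos : 0 < h ^ (m + 1) := by positivity
  set c : ℝ≥0∞ := ENNReal.ofReal (h ^ (m + 1)) with hc
  have hc0 : c ≠ 0 := by simpa [hc] using hpos
  have hct : c ≠ ⊤ := ENNReal.ofReal_ne_top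
  set μ : Measure (Space m) := c⁻¹ • volume.restrict (gridCube h k) with hμ
  have hprob : IsProbabilityMeasure μ := ⟨by
    rw [hμ, Measure.smul_apply, Measure.restrict_apply_univ, volume_gridCube hh, smul_eq_mul,
      ENNReal.inv_mul_cancel hc0 hct]⟩
  have hintμ : Integrable φ μ := hint.smul_measure (by simpa using hc0)
  have h1 : φ x - ((h ^ (m + 1) : ℝ) : ℂ)⁻¹ * ∫ y in gridCube h k, φ y =
      ∫ y, (φ x - φ y) ∂μ := by
    rw [integral_sub (integrable_const _) hintμ, integral_const, probReal_univ, one_smul]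
    congr 1
    rw [hμ, integral_smul_measure, ENNReal.toReal_inv, hc, ENNReal.toReal_ofReal hpos.le,
      Complex.real_smul, Complex.ofReal_inv]
  rw [h1]
  refine (enorm_integral_sq_le (by fun_prop)).trans ?_
  rw [hμ, lintegral_smul_measure, smul_eq_mul]
  refine mul_le_mul_right ?_ _
  rw [← lintegral_indicator (measurableSet_gridCube h k),
    ← lintegral_indicator Metric.isClosed_closedBall.measurableSet,
    ← lintegral_add_right_eq_self _ x]
  refine lintegral_mono fun z => ?_
  by_cases hz : z + x ∈ gridCube h k
  · have hz' : z ∈ Metric.closedBall (0 : Space m) (√((m : ℝ) + 1) * h) := by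
      have := norm_sub_le_of_mem_gridCube hh hx hz
      simpa using this
    rw [Set.indicator_of_mem hz, Set.indicator_of_mem hz', add_comm z x, ← enorm_neg, neg_sub]
  · rw [Set.indicator_of_notMem hz]
    exact zero_le

/-- Averaging over the cubes that meet `Ω`, an operator of finite rank. -/
def gridAverage {Ω : Set (Space m)} (hΩ : Bornology.IsBounded Ω) {h : ℝ} (hh : 0 < h) :
    L2 Ω ℂ →L[ℂ] L2 Ω ℂ :=
  have : IsFiniteMeasure ((volume : Measure (Space m)).restrict Ω) :=
    ⟨by rw [Measure.restrict_apply_univ]; exact hΩ.measure_lt_top⟩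
  ∑ k ∈ (finite_gridCube_meets hΩ hh).toFinset,
    (innerSL ℂ (indicatorConstLp 2 (measurableSet_gridCube h k)
      (measure_ne_top (volume.restrict Ω) _) (1 : ℂ))).smulRight
    (((h ^ (m + 1) : ℝ) : ℂ)⁻¹ • indicatorConstLp 2 (measurableSet_gridCube h k)
      (measure_ne_top (volume.restrict Ω) _) (1 : ℂ))

theorem isCompactOperator_gridAverage {Ω : Set (Space m)} (hΩ : Bornology.IsBounded Ω) {h : ℝ}
    (hh : 0 < h) : IsCompactOperator (gridAverage hΩ hh) := by
  refine (compactOperator (RingHom.id ℂ) (L2 Ω ℂ) (L2 Ω ℂ)).sum_mem fun k _ => ?_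
  exact (isCompactOperator_of_locallyCompactSpace_rng (M₂ := ℂ)
    (ContinuousLinearMap.toSpanSingleton ℂ (_ : L2 Ω ℂ))).comp_clm (innerSL ℂ (_ : L2 Ω ℂ))

theorem gridAverage_apply {Ω : Set (Space m)} (hΩm : MeasurableSet Ω)
    (hΩ : Bornology.IsBounded Ω) {h : ℝ} (hh : 0 < h) (u : L2 Ω ℂ) :
    ∀ᵐ x ∂(volume.restrict Ω), ∀ k, x ∈ gridCube h k →
      gridAverage hΩ hh u x = ((h ^ (m + 1) : ℝ) : ℂ)⁻¹ *
        ∫ y in gridCube h k, u y ∂(volume.restrict Ω) := by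
  have hfin : IsFiniteMeasure ((volume : Measure (Space m)).restrict Ω) :=
    ⟨by rw [Measure.restrict_apply_univ]; exact hΩ.measure_lt_top⟩
  set I : (Fin (m + 1) → ℤ) → L2 Ω ℂ := fun k => indicatorConstLp 2 (measurableSet_gridCube h k)
      (measure_ne_top (volume.restrict Ω) _) (1 : ℂ) with hI
  have h1 : gridAverage hΩ hh u = ∑ k ∈ (finite_gridCube_meets hΩ hh).toFinset,
      (((h ^ (m + 1) : ℝ) : ℂ)⁻¹ * ∫ y in gridCube h k, u y ∂(volume.restrict Ω)) • I k := by
    unfold gridAverage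
    rw [sum_apply]
    refine Finset.sum_congr rfl fun k _ => ?_
    rw [ContinuousLinearMap.smulRight_apply, innerSL_apply_apply, L2.inner_indicatorConstLp_one, smul_smul,
      mul_comm]
  rw [h1]
  have h2 : ∀ᵐ x ∂(volume.restrict Ω), ∀ k, I k x = (gridCube h k).indicator (fun _ => (1 : ℂ)) x :=
    ae_all_iff.2 fun k => indicatorConstLp_coeFn
  have h3 : ∀ᵐ x ∂(volume.restrict Ω), ∀ k, ((((h ^ (m + 1) : ℝ) : ℂ)⁻¹ *
      ∫ y in gridCube h k, u y ∂(volume.restrict Ω)) • I k : L2 Ω ℂ) x = (((h ^ (m + 1) : ℝ) : ℂ)⁻¹ *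
      ∫ y in gridCube h k, u y ∂(volume.restrict Ω)) • I k x :=
    ae_all_iff.2 fun k => Lp.coeFn_smul _ _
  filter_upwards [h2, h3, ae_restrict_mem hΩm, Lp.coeFn_finsetSum
    (finite_gridCube_meets hΩ hh).toFinset fun k => (((h ^ (m + 1) : ℝ) : ℂ)⁻¹ *
      ∫ y in gridCube h k, u y ∂(volume.restrict Ω)) • I k] with x hx hx' hxΩ hsum k hk
  rw [hsum, Finset.sum_apply, Finset.sum_eq_single k]
  · rw [hx', hx, Set.indicator_of_mem hk, smul_eq_mul, mul_one]
  · intro k' _ hne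
    rw [hx', hx, Set.indicator_of_notMem, smul_zero]
    exact fun hk' => hne ((gridCube_unique hk').trans (gridCube_unique hk).symm)
  · intro hk'
    exact absurd ((finite_gridCube_meets hΩ hh).mem_toFinset.2 ⟨x, hxΩ, hk⟩) hk'

/-- The averaging error on a pair `(φ, ∇φ)`. -/
theorem enorm_sub_gridAverage_sq_le {Ω : Set (Space m)} (hΩm : MeasurableSet Ω)
    (hΩ : Bornology.IsBounded Ω) {h : ℝ} (hh : 0 < h) {φ : Space m → ℂ} (hφ : IsTest Ω φ)
    {p : L2 Ω ℂ × L2 Ω (Grad m)} (h1 : p.1 =ᵐ[volume.restrict Ω] φ)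
    (h2 : p.2 =ᵐ[volume.restrict Ω] classicalGrad φ) :
    ‖p.1 - gridAverage hΩ hh p.1‖ₑ ^ 2 ≤ ENNReal.ofReal ((√((m : ℝ) + 1)) ^ (m + 1)) *
      volume (Metric.ball (0 : Space m) 1) * ENNReal.ofReal (√((m : ℝ) + 1) * h) ^ 2 *
        ‖p.2‖ₑ ^ 2 := by
  obtain ⟨hsm, hcs, hts⟩ := hφ
  set r : ℝ := √((m : ℝ) + 1) * h with hr
  have hsm1 : ContDiff ℝ 1 φ := hsm.of_le (by exact_mod_cast le_top)
  have hint : Integrable φ := hsm.continuous.integrable_of_hasCompactSupport hcs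
  have hgrad : ∫⁻ x, ‖classicalGrad φ x‖ₑ ^ 2 = ‖p.2‖ₑ ^ 2 := by
    rw [enorm_sq_eq_lintegral, lintegral_congr_ae (g := fun x => ‖classicalGrad φ x‖ₑ ^ 2)
      (h2.mono fun x hx => by simp only [hx]),
      ← lintegral_indicator hΩm]
    refine lintegral_congr fun x => ?_
    by_cases hx : x ∈ Ω
    · rw [Set.indicator_of_mem hx]
    · rw [Set.indicator_of_notMem hx]
      have : fderiv ℝ φ x = 0 :=
        image_eq_zero_of_notMem_tsupport fun h => hx (hts (tsupport_fderiv_subset ℝ h))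
      have : classicalGrad φ x = 0 := by ext j; simp [classicalGrad, this]
      simp [this]
  have hpt : ∀ᵐ x ∂(volume.restrict Ω), ‖(p.1 - gridAverage hΩ hh p.1 : L2 Ω ℂ) x‖ₑ ^ 2 ≤
      (ENNReal.ofReal (h ^ (m + 1)))⁻¹ *
        ∫⁻ z in Metric.closedBall (0 : Space m) r, ‖φ (x + z) - φ x‖ₑ ^ 2 := by
    filter_upwards [h1, gridAverage_apply hΩm hΩ hh p.1, Lp.coeFn_sub p.1 (gridAverage hΩ hh p.1)]
      with x hx1 hx2 hx3
    have hk := mem_gridCube_floor h x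
    rw [hx3, Pi.sub_apply, hx1, hx2 _ hk]
    have e1 : ∫ y in gridCube h fun j => ⌊x j / h⌋, p.1 y ∂(volume.restrict Ω) =
        ∫ y in gridCube h fun j => ⌊x j / h⌋, φ y := by
      rw [integral_congr_ae (ae_restrict_of_ae h1), Measure.restrict_restrict
        (measurableSet_gridCube _ _), ← integral_indicator (measurableSet_gridCube _ _),
        ← integral_indicator ((measurableSet_gridCube _ _).inter hΩm)]
      refine integral_congr_ae (Eventually.of_forall fun y => ?_)
      by_cases hy : y ∈ gridCube h fun j => ⌊x j / h⌋
      · by_cases hyΩ : y ∈ Ω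
        · simp [hy, hyΩ]
        · simp [hy, hyΩ, image_eq_zero_of_notMem_tsupport fun h => hyΩ (hts h)]
      · simp [hy]
    rw [e1]
    exact enorm_sub_average_sq_le hsm.continuous hh hk hint.integrableOn
  rw [enorm_sq_eq_lintegral]
  refine (lintegral_mono_ae hpt).trans ?_
  have hcont : Continuous (Function.uncurry fun (x z : Space m) => φ (x + z) - φ x) :=
    (hsm.continuous.comp (continuous_fst.add continuous_snd)).sub
      (hsm.continuous.comp continuous_fst)
  have hmeas : Measurable (Function.uncurry fun (x z : Space m) => ‖φ (x + z) - φ x‖ₑ ^ 2) :=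
    hcont.enorm.measurable.pow_const 2
  rw [lintegral_const_mul _ (Measurable.lintegral_prod_right hmeas)]
  have hball : volume (Metric.closedBall (0 : Space m) r) =
      ENNReal.ofReal (h ^ (m + 1)) * (ENNReal.ofReal ((√((m : ℝ) + 1)) ^ (m + 1)) *
        volume (Metric.ball (0 : Space m) 1)) := by
    rw [Measure.addHaar_closedBall _ _ (by positivity), finrank_euclideanSpace_fin, hr, mul_pow,
      mul_comm (_ ^ _), ENNReal.ofReal_mul (by positivity), mul_assoc]
  calc _ ≤ (ENNReal.ofReal (h ^ (m + 1)))⁻¹ * ∫⁻ x,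
          ∫⁻ z in Metric.closedBall (0 : Space m) r, ‖φ (x + z) - φ x‖ₑ ^ 2 := by
        gcongr
        exact Measure.restrict_le_self
    _ = (ENNReal.ofReal (h ^ (m + 1)))⁻¹ * ∫⁻ z in Metric.closedBall (0 : Space m) r,
          ∫⁻ x, ‖φ (x + z) - φ x‖ₑ ^ 2 := by
        rw [lintegral_lintegral_swap hmeas.aemeasurable]
    _ ≤ (ENNReal.ofReal (h ^ (m + 1)))⁻¹ * ∫⁻ z in Metric.closedBall (0 : Space m) r,
          ENNReal.ofReal r ^ 2 * ‖p.2‖ₑ ^ 2 := by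
        refine mul_le_mul_right (setLIntegral_mono measurable_const fun z hz => ?_) _
        refine (lintegral_translate_sub_le hsm1 z).trans ?_
        rw [hgrad]
        gcongr
        rw [← ofReal_norm]
        exact ENNReal.ofReal_le_ofReal (by simpa using hz)
    _ = _ := by
        rw [setLIntegral_const, hball, mul_comm (_ * ‖p.2‖ₑ ^ 2), ← mul_assoc, ← mul_assoc,
          ← mul_assoc, ENNReal.inv_mul_cancel, one_mul]
        · simpa using pow_pos hh _
        · exact ENNReal.ofReal_ne_top

theorem contDiff_one_of_isTest {Ω : Set (Space m)} {φ : Space m → ℂ} (hφ : IsTest Ω φ) :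
    ContDiff ℝ 1 φ := hφ.1.of_le (by exact_mod_cast le_top)

/-- The pairs `(φ, ∇φ)` with `φ` a test function are already a linear space. -/
theorem exists_isTest_of_mem_span {Ω : Set (Space m)} {p : L2 Ω ℂ × L2 Ω (Grad m)}
    (hp : p ∈ Submodule.span ℂ {p : L2 Ω ℂ × L2 Ω (Grad m) | ∃ φ : Space m → ℂ, IsTest Ω φ ∧
      p.1 =ᵐ[volume.restrict Ω] φ ∧ p.2 =ᵐ[volume.restrict Ω] classicalGrad φ}) :
    ∃ φ : Space m → ℂ, IsTest Ω φ ∧ p.1 =ᵐ[volume.restrict Ω] φ ∧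
      p.2 =ᵐ[volume.restrict Ω] classicalGrad φ := by
  induction hp using Submodule.span_induction with
  | mem p hp => exact hp
  | zero =>
    refine ⟨0, ⟨contDiff_const, HasCompactSupport.zero, by simp⟩, Lp.coeFn_zero _ _ _, ?_⟩
    have : classicalGrad (0 : Space m → ℂ) = 0 := by
      ext x j
      simp [classicalGrad]
    rw [this]
    exact Lp.coeFn_zero _ _ _
  | add p p' _ _ hp hp' =>
    obtain ⟨φ, hφ, h1, h2⟩ := hp
    obtain ⟨φ', hφ', h1', h2'⟩ := hp'
    refine ⟨φ + φ', ⟨hφ.1.add hφ'.1, hφ.2.1.add hφ'.2.1, (tsupport_add φ φ').trans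
      (Set.union_subset hφ.2.2 hφ'.2.2)⟩, ?_, ?_⟩
    · exact (Lp.coeFn_add _ _).trans (h1.add h1')
    · refine (Lp.coeFn_add _ _).trans ((h2.add h2').trans (Eventually.of_forall fun x => ?_))
      ext j
      simp [classicalGrad, fderiv_add ((contDiff_one_of_isTest hφ).differentiable (by simp) x)
        ((contDiff_one_of_isTest hφ').differentiable (by simp) x)]
  | smul c p _ hp =>
    obtain ⟨φ, hφ, h1, h2⟩ := hp
    refine ⟨c • φ, ⟨hφ.1.const_smul c, hφ.2.1.comp_left (g := fun y => c • y) (smul_zero c),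
      (tsupport_smul_subset_right (fun _ => c) φ).trans
      hφ.2.2⟩, ?_, ?_⟩
    · filter_upwards [Lp.coeFn_smul c p.1, h1] with x hx hx1
      rw [Prod.smul_fst, hx, Pi.smul_apply, Pi.smul_apply, hx1]
    · filter_upwards [Lp.coeFn_smul c p.2, h2] with x hx hx1
      rw [Prod.smul_snd, hx, Pi.smul_apply, hx1]
      ext j
      simp [classicalGrad, fderiv_const_smul ((contDiff_one_of_isTest hφ).differentiable (by simp) x)]

/-- The averaging error on `H¹₀(Ω)`. -/
theorem exists_norm_sub_gridAverage_le {Ω : Set (Space m)} (hΩm : MeasurableSet Ω)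
    (hΩ : Bornology.IsBounded Ω) : ∃ C : ℝ, 0 ≤ C ∧ ∀ (h : ℝ) (hh : 0 < h),
      ∀ p ∈ H10 Ω, ‖p.1 - gridAverage hΩ hh p.1‖ ≤ C * h * ‖p.2‖ := by
  set A : ℝ≥0∞ := ENNReal.ofReal ((√((m : ℝ) + 1)) ^ (m + 1)) *
      volume (Metric.ball (0 : Space m) 1) with hA
  have hAt : A ≠ ⊤ := ENNReal.mul_ne_top ENNReal.ofReal_ne_top measure_ball_lt_top.ne
  refine ⟨√A.toReal * √((m : ℝ) + 1), by positivity, fun h hh p hp => ?_⟩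
  have hcl : IsClosed {p : L2 Ω ℂ × L2 Ω (Grad m) | ‖p.1 - gridAverage hΩ hh p.1‖ ≤
      √A.toReal * √((m : ℝ) + 1) * h * ‖p.2‖} :=
    isClosed_le (by fun_prop) (by fun_prop)
  refine closure_minimal (fun p hp => ?_) hcl hp
  obtain ⟨φ, hφ, h1, h2⟩ := exists_isTest_of_mem_span hp
  have h3 := ENNReal.toReal_mono (by finiteness) (enorm_sub_gridAverage_sq_le hΩm hΩ hh hφ h1 h2)
  rw [← hA, ENNReal.toReal_mul, ENNReal.toReal_mul, ENNReal.toReal_pow, ENNReal.toReal_pow,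
    ENNReal.toReal_pow, ENNReal.toReal_ofReal (by positivity), toReal_enorm, toReal_enorm] at h3
  refine (pow_le_pow_iff_left₀ (norm_nonneg _) (by positivity) two_ne_zero).1 ?_
  rwa [mul_assoc √A.toReal, mul_pow, mul_pow, Real.sq_sqrt ENNReal.toReal_nonneg]

/-- **Rellich's theorem**: the embedding of `H¹₀(Ω)` into `L²(Ω)` is compact. -/
theorem isCompactOperator_H10_fst {Ω : Set (Space m)} (hΩm : MeasurableSet Ω)
    (hΩ : Bornology.IsBounded Ω) :
    IsCompactOperator ((ContinuousLinearMap.fst ℂ (L2 Ω ℂ) (L2 Ω (Grad m))).comp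
      (H10 Ω).subtypeL) := by
  obtain ⟨C, hC, hle⟩ := exists_norm_sub_gridAverage_le hΩm hΩ
  set J := (ContinuousLinearMap.fst ℂ (L2 Ω ℂ) (L2 Ω (Grad m))).comp (H10 Ω).subtypeL with hJ
  have hh : ∀ n : ℕ, (0 : ℝ) < 1 / ((n : ℝ) + 1) := fun n => by positivity
  refine isCompactOperator_of_tendsto (l := atTop)
    (F := fun n : ℕ => (gridAverage hΩ (hh n)).comp J) ?_
    (Eventually.of_forall fun n => (isCompactOperator_gridAverage hΩ (hh n)).comp_clm J)
  rw [tendsto_iff_norm_sub_tendsto_zero]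
  have hlim : Tendsto (fun n : ℕ => C * (1 / ((n : ℝ) + 1))) atTop (𝓝 0) := by
    simpa using tendsto_one_div_add_atTop_nhds_zero_nat.const_mul C
  refine squeeze_zero (fun _ => norm_nonneg _) (fun n => ?_) hlim
  refine ContinuousLinearMap.opNorm_le_bound _ (mul_nonneg hC (hh n).le) fun p => ?_
  rw [← norm_neg]
  have h1 := hle _ (hh n) p.1 p.2
  have h2 : ‖p.1.2‖ ≤ ‖p‖ := norm_snd_le p.1
  calc _ = ‖p.1.1 - gridAverage hΩ (hh n) p.1.1‖ := by
        congr 1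
        simp [hJ]
    _ ≤ C * (1 / ((n : ℝ) + 1)) * ‖p.1.2‖ := h1
    _ ≤ _ := mul_le_mul_of_nonneg_left h2 (mul_nonneg hC (hh n).le)

end Rellich

/-! ### The energy space of an elliptic operator -/

section Multiplication

variable {m : ℕ} {Ω : Set (Space m)} {F : Type} [NormedAddCommGroup F] [InnerProductSpace ℂ F]

theorem memLp_coeff_smul {w : Space m → ℝ} (hw : IsCoeff w) (u : L2 Ω F) :
    MemLp (fun x => (w x : ℂ) • u x) 2 (volume.restrict Ω) := by
  obtain ⟨hm, C, hC⟩ := hw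
  refine (Lp.memLp u).of_le_mul (c := C)
    ((Complex.measurable_ofReal.comp hm).aestronglyMeasurable.smul (Lp.aestronglyMeasurable u))
    (Eventually.of_forall fun x => ?_)
  rw [norm_smul, Complex.norm_real]
  exact mul_le_mul_of_nonneg_right (hC x) (norm_nonneg _)

/-- Multiplication by a bounded measurable real function. -/
def mulCoeff (Ω : Set (Space m)) (F : Type) [NormedAddCommGroup F] [InnerProductSpace ℂ F]
    {w : Space m → ℝ} (hw : IsCoeff w) : L2 Ω F →L[ℂ] L2 Ω F :=
  LinearMap.mkContinuousOfExistsBound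
    { toFun := fun u => (memLp_coeff_smul hw u).toLp
      map_add' := fun u v => by
        refine Lp.ext ?_
        filter_upwards [(memLp_coeff_smul hw (u + v)).coeFn_toLp, (memLp_coeff_smul hw u).coeFn_toLp,
          (memLp_coeff_smul hw v).coeFn_toLp, Lp.coeFn_add u v,
          Lp.coeFn_add (memLp_coeff_smul hw u).toLp (memLp_coeff_smul hw v).toLp]
          with x h1 h2 h3 h4 h5
        rw [h1, h5, Pi.add_apply, h2, h3, h4, Pi.add_apply, smul_add]
      map_smul' := fun c u => by
        refine Lp.ext ?_
        filter_upwards [(memLp_coeff_smul hw (c • u)).coeFn_toLp, (memLp_coeff_smul hw u).coeFn_toLp,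
          Lp.coeFn_smul c u, Lp.coeFn_smul c (memLp_coeff_smul hw u).toLp] with x h1 h2 h3 h4
        rw [h1, RingHom.id_apply, h4, Pi.smul_apply, h2, h3, Pi.smul_apply, smul_comm] }
    (by
      obtain ⟨C, hC⟩ := hw.2
      refine ⟨C, fun u => Lp.norm_le_mul_norm_of_ae_le_mul ?_⟩
      filter_upwards [(memLp_coeff_smul hw u).coeFn_toLp] with x hx
      simp only [LinearMap.coe_mk, AddHom.coe_mk]
      rw [hx, norm_smul, Complex.norm_real]
      exact mul_le_mul_of_nonneg_right (hC x) (norm_nonneg _))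

theorem mulCoeff_apply {w : Space m → ℝ} (hw : IsCoeff w) (u : L2 Ω F) :
    ∀ᵐ x ∂(volume.restrict Ω), mulCoeff Ω F hw u x = (w x : ℂ) • u x :=
  (memLp_coeff_smul hw u).coeFn_toLp

theorem mulCoeff_mulCoeff {w w' : Space m → ℝ} (hw : IsCoeff w) (hw' : IsCoeff w')
    (h : ∀ x, w x * w' x = 1) (u : L2 Ω F) : mulCoeff Ω F hw (mulCoeff Ω F hw' u) = u := by
  refine Lp.ext ?_
  filter_upwards [mulCoeff_apply hw (mulCoeff Ω F hw' u), mulCoeff_apply hw' u] with x h1 h2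
  rw [h1, h2, smul_smul, ← Complex.ofReal_mul, h, Complex.ofReal_one, one_smul]

theorem weighted_mulCoeff {w v : Space m → ℝ} (hv : IsCoeff v)
    (h : ∀ x, w x * (v x * v x) = 1) (u u' : L2 Ω F) :
    weighted Ω w (mulCoeff Ω F hv u) (mulCoeff Ω F hv u') = inner ℂ u' u := by
  rw [L2.inner_def]
  unfold weighted
  refine integral_congr_ae ?_
  filter_upwards [mulCoeff_apply hv u, mulCoeff_apply hv u'] with x h1 h2
  rw [h1, h2, inner_smul_left, inner_smul_right, Complex.conj_ofReal, ← mul_assoc, ← mul_assoc,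
    mul_assoc (w x : ℂ), ← Complex.ofReal_mul, ← Complex.ofReal_mul, h, Complex.ofReal_one, one_mul]

end Multiplication

/-- Bounded measurable coefficients with a positive lower bound. -/
def IsEllipticCoeff {m : ℕ} (w : Space m → ℝ) : Prop :=
  IsCoeff w ∧ ∃ c : ℝ, 0 < c ∧ ∀ x, c ≤ w x

theorem IsEllipticCoeff.pos {m : ℕ} {w : Space m → ℝ} (hw : IsEllipticCoeff w) (x : Space m) :
    0 < w x := by
  obtain ⟨-, c, hc, h⟩ := hw
  exact hc.trans_le (h x)

theorem IsEllipticCoeff.sqrt {m : ℕ} {w : Space m → ℝ} (hw : IsEllipticCoeff w) :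
    IsCoeff fun x => √(w x) := by
  obtain ⟨⟨hm, C, hC⟩, -⟩ := hw
  refine ⟨hm.sqrt, √C, fun x => ?_⟩
  rw [abs_of_nonneg (Real.sqrt_nonneg _)]
  exact Real.sqrt_le_sqrt ((le_abs_self _).trans (hC x))

theorem IsEllipticCoeff.inv_sqrt {m : ℕ} {w : Space m → ℝ} (hw : IsEllipticCoeff w) :
    IsCoeff fun x => (√(w x))⁻¹ := by
  obtain ⟨⟨hm, -⟩, c, hc, h⟩ := hw
  refine ⟨hm.sqrt.inv, (√c)⁻¹, fun x => ?_⟩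
  rw [abs_of_nonneg (by positivity)]
  exact inv_anti₀ (Real.sqrt_pos.2 hc) (Real.sqrt_le_sqrt (h x))

section Energy

variable {m : ℕ} {Ω : Set (Space m)} {a b : Space m → ℝ}

/-- Division of the two entries of a pair by `√b` and `√a`. -/
def unweight (Ω : Set (Space m)) (ha : IsEllipticCoeff a) (hb : IsEllipticCoeff b) :
    WithLp 2 (L2 Ω ℂ × L2 Ω (Grad m)) →L[ℂ] L2 Ω ℂ × L2 Ω (Grad m) :=
  ((mulCoeff Ω ℂ hb.inv_sqrt).prodMap (mulCoeff Ω (Grad m) ha.inv_sqrt)).comp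
    (WithLp.prodContinuousLinearEquiv 2 ℂ (L2 Ω ℂ) (L2 Ω (Grad m)) :
      WithLp 2 (L2 Ω ℂ × L2 Ω (Grad m)) →L[ℂ] L2 Ω ℂ × L2 Ω (Grad m))

/-- Multiplication of the two entries of a pair by `√b` and `√a`. -/
def weight (Ω : Set (Space m)) (ha : IsEllipticCoeff a) (hb : IsEllipticCoeff b)
    (p : L2 Ω ℂ × L2 Ω (Grad m)) : WithLp 2 (L2 Ω ℂ × L2 Ω (Grad m)) :=
  WithLp.toLp 2 (mulCoeff Ω ℂ hb.sqrt p.1, mulCoeff Ω (Grad m) ha.sqrt p.2)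

theorem unweight_weight (ha : IsEllipticCoeff a) (hb : IsEllipticCoeff b)
    (p : L2 Ω ℂ × L2 Ω (Grad m)) : unweight Ω ha hb (weight Ω ha hb p) = p :=
  Prod.ext
    (mulCoeff_mulCoeff hb.inv_sqrt hb.sqrt (fun x => inv_mul_cancel₀ (Real.sqrt_pos.2 (hb.pos x)).ne') p.1)
    (mulCoeff_mulCoeff ha.inv_sqrt ha.sqrt (fun x => inv_mul_cancel₀ (Real.sqrt_pos.2 (ha.pos x)).ne') p.2)

theorem weight_unweight (ha : IsEllipticCoeff a) (hb : IsEllipticCoeff b)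
    (y : WithLp 2 (L2 Ω ℂ × L2 Ω (Grad m))) : weight Ω ha hb (unweight Ω ha hb y) = y := by
  refine (WithLp.ofLp_injective 2) (Prod.ext ?_ ?_)
  · exact mulCoeff_mulCoeff hb.sqrt hb.inv_sqrt (fun x => mul_inv_cancel₀ (Real.sqrt_pos.2 (hb.pos x)).ne') y.fst
  · exact mulCoeff_mulCoeff ha.sqrt ha.inv_sqrt (fun x => mul_inv_cancel₀ (Real.sqrt_pos.2 (ha.pos x)).ne') y.snd

theorem weighted_unweight_fst (ha : IsEllipticCoeff a) (hb : IsEllipticCoeff b)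
    (y y' : WithLp 2 (L2 Ω ℂ × L2 Ω (Grad m))) :
    weighted Ω b (unweight Ω ha hb y).1 (unweight Ω ha hb y').1 = inner ℂ y'.fst y.fst :=
  weighted_mulCoeff hb.inv_sqrt (fun x => by
    rw [← mul_inv, Real.mul_self_sqrt (hb.pos x).le, mul_inv_cancel₀ (hb.pos x).ne']) _ _

theorem weighted_unweight_snd (ha : IsEllipticCoeff a) (hb : IsEllipticCoeff b)
    (y y' : WithLp 2 (L2 Ω ℂ × L2 Ω (Grad m))) :
    weighted Ω a (unweight Ω ha hb y).2 (unweight Ω ha hb y').2 = inner ℂ y'.snd y.snd :=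
  weighted_mulCoeff ha.inv_sqrt (fun x => by
    rw [← mul_inv, Real.mul_self_sqrt (ha.pos x).le, mul_inv_cancel₀ (ha.pos x).ne']) _ _

/-- The space `H¹₀(Ω)` with the scalar product `∫ a ∇u · ∇v̄ + ∫ b u v̄`. The pair `(u, ∇u)` is
represented by `(√b u, √a ∇u)`, so that this is a closed subspace of an `L²` space. -/
def energySpace (Ω : Set (Space m)) (ha : IsEllipticCoeff a) (hb : IsEllipticCoeff b) :
    Submodule ℂ (WithLp 2 (L2 Ω ℂ × L2 Ω (Grad m))) :=
  (H10 Ω).comap (unweight Ω ha hb).toLinearMap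

theorem isClosed_energySpace (ha : IsEllipticCoeff a) (hb : IsEllipticCoeff b) :
    IsClosed (energySpace Ω ha hb : Set (WithLp 2 (L2 Ω ℂ × L2 Ω (Grad m)))) :=
  (Submodule.isClosed_topologicalClosure _).preimage (unweight Ω ha hb).continuous

instance completeSpace_energySpace (ha : IsEllipticCoeff a) (hb : IsEllipticCoeff b) :
    CompleteSpace (energySpace Ω ha hb) :=
  (isClosed_energySpace ha hb).completeSpace_coe

/-- The element of the energy space given by an element of `H¹₀(Ω)`. -/
def toEnergy (ha : IsEllipticCoeff a) (hb : IsEllipticCoeff b) {p : L2 Ω ℂ × L2 Ω (Grad m)}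
    (hp : p ∈ H10 Ω) : energySpace Ω ha hb :=
  ⟨weight Ω ha hb p, by
    rw [energySpace, Submodule.mem_comap]
    exact (unweight_weight ha hb p).symm ▸ hp⟩

/-- The map `u ↦ √b u` from the energy space to `L²(Ω)`. -/
def energyFst (Ω : Set (Space m)) (ha : IsEllipticCoeff a) (hb : IsEllipticCoeff b) :
    energySpace Ω ha hb →L[ℂ] L2 Ω ℂ :=
  (WithLp.fstL 2 ℂ (L2 Ω ℂ) (L2 Ω (Grad m))).comp (energySpace Ω ha hb).subtypeL

theorem inner_energyFst (ha : IsEllipticCoeff a) (hb : IsEllipticCoeff b)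
    (y y' : energySpace Ω ha hb) : inner ℂ (energyFst Ω ha hb y') (energyFst Ω ha hb y) =
      weighted Ω b (unweight Ω ha hb y).1 (unweight Ω ha hb y').1 :=
  (weighted_unweight_fst ha hb y.1 y'.1).symm

theorem inner_energySpace (ha : IsEllipticCoeff a) (hb : IsEllipticCoeff b)
    (y y' : energySpace Ω ha hb) : inner ℂ y' y =
      weighted Ω b (unweight Ω ha hb y).1 (unweight Ω ha hb y').1 +
        weighted Ω a (unweight Ω ha hb y).2 (unweight Ω ha hb y').2 := by
  rw [weighted_unweight_fst, weighted_unweight_snd, Submodule.coe_inner, WithLp.prod_inner_apply]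
  rfl

theorem injective_unweight_fst (hΩ : IsOpen Ω) (ha : IsEllipticCoeff a) (hb : IsEllipticCoeff b)
    {y : energySpace Ω ha hb} (h : (unweight Ω ha hb y).1 = 0) : y = 0 := by
  have h1 : ((0 : L2 Ω ℂ), (unweight Ω ha hb y).2) ∈ H10 Ω := by
    rw [← h]; exact y.2
  have h2 : unweight Ω ha hb y = 0 := Prod.ext h (H10_snd_eq_zero hΩ h1)
  refine Subtype.ext ?_
  rw [← weight_unweight ha hb y.1, h2]
  refine (WithLp.ofLp_injective 2) (Prod.ext ?_ ?_) <;> exact map_zero _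

theorem injective_energyFst (hΩ : IsOpen Ω) (ha : IsEllipticCoeff a) (hb : IsEllipticCoeff b) :
    Function.Injective (energyFst Ω ha hb) := by
  refine (injective_iff_map_eq_zero _).2 fun y hy => injective_unweight_fst hΩ ha hb ?_
  have : (y : WithLp 2 (L2 Ω ℂ × L2 Ω (Grad m))).fst = 0 := hy
  change mulCoeff Ω ℂ hb.inv_sqrt (y : WithLp 2 (L2 Ω ℂ × L2 Ω (Grad m))).fst = 0
  rw [this, map_zero]

theorem isCompactOperator_energyFst (hΩ : IsOpen Ω) (hΩb : Bornology.IsBounded Ω)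
    (ha : IsEllipticCoeff a) (hb : IsEllipticCoeff b) : IsCompactOperator (energyFst Ω ha hb) := by
  let Q : energySpace Ω ha hb →L[ℂ] H10 Ω :=
    ((unweight Ω ha hb).comp (energySpace Ω ha hb).subtypeL).codRestrict (H10 Ω) fun y => y.2
  have h1 := ((isCompactOperator_H10_fst hΩ.measurableSet hΩb).comp_clm Q).clm_comp
    (mulCoeff Ω ℂ hb.sqrt)
  refine (congrArg IsCompactOperator (funext fun y => ?_)).mpr h1
  exact (mulCoeff_mulCoeff hb.sqrt hb.inv_sqrt
    (fun x => mul_inv_cancel₀ (Real.sqrt_pos.2 (hb.pos x)).ne') y.1.fst).symm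

theorem norm_energyFst_le (ha : IsEllipticCoeff a) (hb : IsEllipticCoeff b)
    (y : energySpace Ω ha hb) : ‖energyFst Ω ha hb y‖ ≤ ‖y‖ :=
  WithLp.norm_fst_le (L2 Ω ℂ) y.1

theorem eigenspace_ellipticOperator (hΩ : IsOpen Ω) (ha : IsEllipticCoeff a)
    (hb : IsEllipticCoeff b) (μ : ℂ) : eigenspace (ellipticOperator Ω ha.1 hb.1) μ =
      (formEigenspace (energyFst Ω ha hb) μ).map
        ((LinearMap.fst ℂ _ _).comp
          ((unweight Ω ha hb).toLinearMap.comp (energySpace Ω ha hb).subtype)) := by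
  have hgraph : (ellipticOperator Ω ha.1 hb.1).graph = operatorGraph Ω ha.1 hb.1 :=
    Submodule.toLinearPMap_graph_eq _
      (operatorGraph_snd_eq_zero hΩ ha.1 hb.1 fun x => (hb.pos x).ne')
  ext u
  rw [eigenspace, Submodule.mem_comap, hgraph, Submodule.mem_map]
  constructor
  · rintro ⟨g, hg, H⟩
    refine ⟨toEnergy ha hb hg, fun y' => ?_, congrArg Prod.fst (unweight_weight ha hb (u, g))⟩
    have h1 : unweight Ω ha hb (toEnergy ha hb hg : energySpace Ω ha hb) = (u, g) :=
      unweight_weight ha hb (u, g)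
    rw [inner_energySpace, inner_energyFst, h1]
    have h2 := H _ _ y'.2
    change weighted Ω a g _ = weighted Ω b (μ • u) _ at h2
    rw [weighted_smul] at h2
    rw [add_mul, one_mul]
    exact congrArg (weighted Ω b u (unweight Ω ha hb y').1 + ·) h2
  · rintro ⟨y, hy, rfl⟩
    refine ⟨(unweight Ω ha hb y).2, y.2, fun v h hvh => ?_⟩
    have h1 : unweight Ω ha hb (toEnergy ha hb hvh : energySpace Ω ha hb) = (v, h) :=
      unweight_weight ha hb (v, h)
    have h2 := hy (toEnergy ha hb hvh)
    rw [inner_energySpace, inner_energyFst, h1, add_mul, one_mul] at h2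
    have h3 := add_left_cancel h2
    change _ = weighted Ω b (μ • (unweight Ω ha hb y).1) v
    rw [weighted_smul]
    exact h3

theorem rank_eigenspace_ellipticOperator (hΩ : IsOpen Ω) (ha : IsEllipticCoeff a)
    (hb : IsEllipticCoeff b) (μ : ℂ) :
    Module.rank ℂ (eigenspace (ellipticOperator Ω ha.1 hb.1) μ) =
      Module.rank ℂ (formEigenspace (energyFst Ω ha hb) μ) := by
  rw [eigenspace_ellipticOperator hΩ ha hb]
  refine (Submodule.equivMapOfInjective _ ?_ _).rank_eq.symm
  exact (injective_iff_map_eq_zero _).2 fun y hy => injective_unweight_fst hΩ ha hb hy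

theorem not_finiteDimensional_energySpace (ha : IsEllipticCoeff a) (hb : IsEllipticCoeff b)
    (h : ∀ N : ℕ, ∃ p : Fin N → L2 Ω ℂ × L2 Ω (Grad m), (∀ i, p i ∈ H10 Ω) ∧
      LinearIndependent ℂ fun i => (p i).1) : ¬ FiniteDimensional ℂ (energySpace Ω ha hb) := by
  intro hfin
  obtain ⟨p, hp, hli⟩ := h (Module.finrank ℂ (energySpace Ω ha hb) + 1)
  have h1 : LinearIndependent ℂ fun i => toEnergy ha hb (hp i) := by
    refine LinearIndependent.of_comp ((LinearMap.fst ℂ _ _).comp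
          ((unweight Ω ha hb).toLinearMap.comp (energySpace Ω ha hb).subtype)) ?_
    convert hli using 2 with i
    exact congrArg Prod.fst (unweight_weight ha hb (p i))
  have := h1.fintype_card_le_finrank
  simp at this

/-- The eigenvalues of an elliptic operator on a bounded open set form an ascending sequence, provided
`H¹₀(Ω)` is infinite-dimensional. -/
theorem exists_isEigenvalueSequence (hΩ : IsOpen Ω) (hΩb : Bornology.IsBounded Ω)
    (ha : IsEllipticCoeff a) (hb : IsEllipticCoeff b)
    (h : ∀ N : ℕ, ∃ p : Fin N → L2 Ω ℂ × L2 Ω (Grad m), (∀ i, p i ∈ H10 Ω) ∧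
      LinearIndependent ℂ fun i => (p i).1) :
    ∃ l : ℕ → ℝ, IsEigenvalueSequence (ellipticOperator Ω ha.1 hb.1) l := by
  obtain ⟨l, hl, hl'⟩ := exists_formEigenvalue_sequence
    (isCompactOperator_energyFst hΩ hΩb ha hb) (injective_energyFst hΩ ha hb)
    (not_finiteDimensional_energySpace ha hb h)
  exact ⟨l, hl, fun μ => by rw [hl', rank_eigenspace_ellipticOperator hΩ ha hb]⟩

theorem norm_toEnergy_sq (ha : IsEllipticCoeff a) (hb : IsEllipticCoeff b)
    {p : L2 Ω ℂ × L2 Ω (Grad m)} (hp : p ∈ H10 Ω) :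
    ‖toEnergy ha hb hp‖ ^ 2 = (weighted Ω b p.1 p.1).re + (weighted Ω a p.2 p.2).re := by
  have h1 := inner_energySpace ha hb (toEnergy ha hb hp) (toEnergy ha hb hp)
  rw [inner_self_eq_ofReal, toEnergy, unweight_weight] at h1
  exact congrArg Complex.re h1

theorem norm_energyFst_toEnergy_sq (ha : IsEllipticCoeff a) (hb : IsEllipticCoeff b)
    {p : L2 Ω ℂ × L2 Ω (Grad m)} (hp : p ∈ H10 Ω) :
    ‖energyFst Ω ha hb (toEnergy ha hb hp)‖ ^ 2 = (weighted Ω b p.1 p.1).re := by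
  have h1 := inner_energyFst ha hb (toEnergy ha hb hp) (toEnergy ha hb hp)
  rw [inner_self_eq_ofReal] at h1
  have h2 := congrArg Complex.re h1
  rw [Complex.ofReal_re] at h2
  rw [h2, toEnergy, unweight_weight]

/-- The min-max bound for elliptic operators. -/
theorem eigenvalue_le_of_orthogonal (hΩ : IsOpen Ω) (hΩb : Bornology.IsBounded Ω)
    (ha : IsEllipticCoeff a) (hb : IsEllipticCoeff b) {l : ℕ → ℝ}
    (hl : IsEigenvalueSequence (ellipticOperator Ω ha.1 hb.1) l) {k : ℕ} {c : ℝ}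
    (p : Fin (k + 1) → L2 Ω ℂ × L2 Ω (Grad m)) (hp : ∀ i, p i ∈ H10 Ω)
    (hp0 : ∀ i, (p i).1 ≠ 0)
    (horth : Pairwise fun i j => weighted Ω b (p i).1 (p j).1 = 0 ∧
      weighted Ω a (p i).2 (p j).2 = 0)
    (hc : ∀ i, (weighted Ω a (p i).2 (p i).2).re ≤ c * (weighted Ω b (p i).1 (p i).1).re) :
    l k ≤ c := by
  have hun : ∀ i, unweight Ω ha hb (toEnergy ha hb (hp i) : energySpace Ω ha hb) = p i :=
    fun i => unweight_weight ha hb (p i)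
  refine formEigenvalue_le_of_orthogonal (isCompactOperator_energyFst hΩ hΩb ha hb)
    (injective_energyFst hΩ ha hb) hl.1 (fun μ => ?_) (fun i => toEnergy ha hb (hp i))
    (fun i h0 => hp0 i ?_) (fun i j hij => ?_) (fun i j hij => ?_) (fun i => ?_)
  · rw [hl.2, rank_eigenspace_ellipticOperator hΩ ha hb]
  · rw [← hun i, h0]
    exact congrArg Prod.fst (map_zero (unweight Ω ha hb))
  · simp only [inner_energySpace, hun]
    rw [(horth hij.symm).1, (horth hij.symm).2, add_zero]
  · simp only [inner_energyFst, hun]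
    exact (horth hij.symm).1
  · rw [norm_toEnergy_sq, norm_energyFst_toEnergy_sq]
    linarith [hc i]

theorem eigenvalue_nonneg (hΩ : IsOpen Ω) (ha : IsEllipticCoeff a) (hb : IsEllipticCoeff b)
    {l : ℕ → ℝ} (hl : IsEigenvalueSequence (ellipticOperator Ω ha.1 hb.1) l) (k : ℕ) :
    0 ≤ l k := by
  have h1 : formEigenspace (energyFst Ω ha hb) (l k : ℂ) ≠ ⊥ := by
    intro hbot
    have h2 := hl.2 (l k)
    rw [rank_eigenspace_ellipticOperator hΩ ha hb, hbot, rank_bot, map_zero,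
      Set.encard_eq_zero] at h2
    exact (Set.eq_empty_iff_forall_notMem.1 h2 k) rfl
  obtain ⟨y, hy, hy0⟩ := (Submodule.ne_bot_iff _).1 h1
  have h2 := hy y
  rw [inner_self_eq_ofReal, inner_self_eq_ofReal] at h2
  have h3 : ‖y‖ ^ 2 = (1 + l k) * ‖energyFst Ω ha hb y‖ ^ 2 := by exact_mod_cast h2
  have h4 : 0 < ‖energyFst Ω ha hb y‖ ^ 2 := by
    have : energyFst Ω ha hb y ≠ 0 := fun h =>
      hy0 (injective_energyFst hΩ ha hb (h.trans (map_zero _).symm))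
    positivity
  have h5 := pow_le_pow_left₀ (norm_nonneg _) (norm_energyFst_le ha hb y) 2
  nlinarith

end Energy

section TestFunctionsAndLattice

/-! ### Radial test functions -/

/-- A smooth transition from `0` on `(-∞, 0]` to `1` on `[1, ∞)` with slope at most `L`. -/
structure IsStep (χ : ℝ → ℝ) (L : ℝ) : Prop where
  contDiff : ContDiff ℝ ∞ χ
  eq_zero : ∀ t ≤ 0, χ t = 0
  eq_one : ∀ t, 1 ≤ t → χ t = 1
  nonneg : ∀ t, 0 ≤ χ t
  le_one : ∀ t, χ t ≤ 1
  lipschitz : ∀ s t, |χ s - χ t| ≤ L * |s - t|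

/-- The primitive of a normalised bump on `(0, 1)` that is almost constant has slope close to `1`. -/
theorem exists_isStep {δ : ℝ} (hδ : 0 < δ) : ∃ χ, IsStep χ (1 + δ) := by
  have hin : 1 / (2 * (1 + δ)) < (1 / 2 : ℝ) := by
    rw [div_lt_div_iff₀ (by positivity) (by norm_num)]
    linarith
  let f : ContDiffBump (1 / 2 : ℝ) := ⟨1 / (2 * (1 + δ)), 1 / 2, by positivity, hin⟩
  set g : ℝ → ℝ := f.normed volume with hg
  have hgc : Continuous g := f.continuous_normed
  have hg0 : ∀ t, 0 ≤ g t := f.nonneg_normed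
  have hgle : ∀ t, g t ≤ 1 + δ := fun t => by
    refine (f.normed_le_div_measure_closedBall_rIn volume t).trans_eq ?_
    have hf : f.rIn = 1 / (2 * (1 + δ)) := rfl
    rw [Measure.real, Real.volume_closedBall, hf, ENNReal.toReal_ofReal (by positivity)]
    field_simp
  have hgsupp : ∀ t, t ∉ Ioo (0 : ℝ) 1 → g t = 0 := fun t ht => by
    have h1 : Function.support g = Metric.ball (1 / 2 : ℝ) (1 / 2) := f.support_normed_eq
    by_contra h
    have h2 : t ∈ Metric.ball (1 / 2 : ℝ) (1 / 2) := h1 ▸ h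
    rw [Real.ball_eq_Ioo] at h2
    norm_num at h2
    exact ht h2
  set χ : ℝ → ℝ := fun t => ∫ s in (0 : ℝ)..t, g s with hχ
  have hder : ∀ t, HasDerivAt χ (g t) t := fun t =>
    intervalIntegral.integral_hasDerivAt_right (hgc.intervalIntegrable _ _)
      (hgc.stronglyMeasurableAtFilter _ _) hgc.continuousAt
  have hdiff : Differentiable ℝ χ := fun t => (hder t).differentiableAt
  have hderiv : deriv χ = g := funext fun t => (hder t).deriv
  have hmono : Monotone χ := monotone_of_deriv_nonneg hdiff fun t => by
    rw [hderiv]; exact hg0 t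
  have hzero : ∀ t ≤ 0, χ t = 0 := fun t ht => by
    refine (intervalIntegral.integral_congr fun s hs => ?_).trans intervalIntegral.integral_zero
    rw [Set.uIcc_of_ge ht] at hs
    exact hgsupp s fun h => (h.1.trans_le hs.2).false
  have hone : ∀ t, 1 ≤ t → χ t = 1 := fun t ht => by
    have h1 : ∫ s, g s = 1 := f.integral_normed
    rw [hχ, ← h1]
    simp only
    rw [intervalIntegral.integral_of_le (zero_le_one.trans ht)]
    refine setIntegral_eq_integral_of_forall_compl_eq_zero fun s hs => hgsupp s fun h => hs ?_
    exact ⟨h.1, h.2.le.trans ht⟩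
  refine ⟨χ, ?_, hzero, hone, fun t => ?_, fun t => ?_, fun s t => ?_⟩
  · rw [contDiff_infty_iff_deriv, hderiv]
    exact ⟨hdiff, f.contDiff_normed⟩
  · rcases le_total t 0 with h | h
    · rw [hzero t h]
    · rw [← hzero 0 le_rfl]; exact hmono h
  · rcases le_total 1 t with h | h
    · rw [hone t h]
    · rw [← hone 1 le_rfl]; exact hmono h
  · have h1 : LipschitzWith (Real.toNNReal (1 + δ)) χ := by
      refine lipschitzWith_of_nnnorm_deriv_le hdiff fun t => ?_
      rw [hderiv, ← NNReal.coe_le_coe, coe_nnnorm, Real.norm_of_nonneg (hg0 t),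
        Real.coe_toNNReal _ (by positivity)]
      exact hgle t
    have h2 := h1.dist_le_mul s t
    rwa [Real.dist_eq, Real.dist_eq, Real.coe_toNNReal _ (by positivity)] at h2

variable {m : ℕ}

/-- The radial function equal to `1` on the core and to `0` outside the outer ball, with the
transition `χ` across the shell. -/
def radial (χ : ℝ → ℝ) (c : Space m) (ρ d : ℝ) (x : Space m) : ℝ := χ ((ρ - dist x c) / d)

section Radial

variable {χ : ℝ → ℝ} {L : ℝ} {c : Space m} {ρ d : ℝ}

theorem radial_eq_one (hχ : IsStep χ L) (hd : 0 < d) {x : Space m} (hx : dist x c ≤ ρ - d) :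
    radial χ c ρ d x = 1 :=
  hχ.eq_one _ (by rw [le_div_iff₀ hd]; linarith)

theorem radial_eq_zero (hχ : IsStep χ L) (hd : 0 < d) {x : Space m} (hx : ρ ≤ dist x c) :
    radial χ c ρ d x = 0 :=
  hχ.eq_zero _ (div_nonpos_of_nonpos_of_nonneg (by linarith) hd.le)

theorem contDiff_radial (hχ : IsStep χ L) (hd : 0 < d) (hρ : d < ρ) :
    ContDiff ℝ ∞ (radial χ c ρ d) := by
  refine contDiff_iff_contDiffAt.2 fun x => ?_
  by_cases hx : x = c
  -- the distance is not smooth at the centre, but the function is constant there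
  · have h1 : radial χ c ρ d =ᶠ[𝓝 x] fun _ => 1 := by
      filter_upwards [Metric.ball_mem_nhds x (sub_pos.2 hρ)] with y hy
      rw [hx] at hy
      exact radial_eq_one hχ hd (le_of_lt hy)
    exact contDiffAt_const.congr_of_eventuallyEq h1
  · have h1 : ContDiffAt ℝ ∞ (fun x : Space m => dist x c) x :=
      contDiffAt_id.dist ℝ contDiffAt_const hx
    exact hχ.contDiff.contDiffAt.comp x ((contDiffAt_const.sub h1).div_const d)

theorem norm_fderiv_radial_le (hχ : IsStep χ L) (hL : 0 ≤ L) (hd : 0 < d) (x : Space m) :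
    ‖fderiv ℝ (radial χ c ρ d) x‖ ≤ L / d := by
  have h1 : LipschitzWith ⟨L / d, by positivity⟩ (radial χ c ρ d) := by
    refine LipschitzWith.of_dist_le_mul fun y z => ?_
    rw [Real.dist_eq]
    refine (hχ.lipschitz _ _).trans ?_
    have h2 : |(ρ - dist y c) / d - (ρ - dist z c) / d| ≤ dist y z / d := by
      rw [← sub_div, abs_div, abs_of_pos hd]
      gcongr
      rw [sub_sub_sub_cancel_left, abs_sub_comm]
      exact abs_dist_sub_le y z c
    refine (mul_le_mul_of_nonneg_left h2 hL).trans_eq ?_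
    change _ = L / d * _
    ring
  exact norm_fderiv_le_of_lipschitz ℝ h1

/-- Outside the shell the function attains one of its extreme values `0` and `1`. -/
theorem fderiv_radial_eq_zero (hχ : IsStep χ L) (hd : 0 < d) {x : Space m}
    (hx : x ∉ shell c ρ d) : fderiv ℝ (radial χ c ρ d) x = 0 := by
  have hx : dist x c ≤ ρ - d ∨ ρ ≤ dist x c := by
    by_contra! h
    exact hx h
  rcases hx with h | h
  · refine IsLocalMax.fderiv_eq_zero (Eventually.of_forall fun y => ?_)
    rw [radial_eq_one hχ hd h]
    exact hχ.le_one _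
  · refine IsLocalMin.fderiv_eq_zero (Eventually.of_forall fun y => ?_)
    rw [radial_eq_zero hχ hd h]
    exact hχ.nonneg _

theorem norm_classicalGrad_ofReal_le {u : Space m → ℝ} {x : Space m}
    (hu : DifferentiableAt ℝ u x) :
    ‖classicalGrad (fun y => (u y : ℂ)) x‖ ≤ ‖fderiv ℝ u x‖ := by
  have h1 : ∀ z, fderiv ℝ (fun y => (u y : ℂ)) x z = ((fderiv ℝ u x z : ℝ) : ℂ) := fun z => by
    have := (Complex.ofRealCLM.hasFDerivAt.comp x hu.hasFDerivAt).fderiv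
    change fderiv ℝ (fun y => (u y : ℂ)) x = _ at this
    rw [this]
    rfl
  set v : Space m := WithLp.toLp 2 fun j => fderiv ℝ u x (EuclideanSpace.single j 1) with hv
  have hnorm : ‖classicalGrad (fun y => (u y : ℂ)) x‖ = ‖v‖ := by
    rw [EuclideanSpace.norm_eq, EuclideanSpace.norm_eq]
    simp [classicalGrad, h1, hv]
  have h2 : fderiv ℝ u x v = ‖v‖ ^ 2 := by
    have hz : v = ∑ j, v j • (EuclideanSpace.single j 1 : Space m) := by
      ext i
      simp [Finset.sum_apply, Pi.single_apply]
    conv_lhs => rw [hz]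
    rw [map_sum, EuclideanSpace.norm_sq_eq]
    refine Finset.sum_congr rfl fun j _ => ?_
    rw [map_smul, Real.norm_eq_abs, sq_abs, smul_eq_mul, sq]
  have h3 := (le_abs_self _).trans ((fderiv ℝ u x).le_opNorm v)
  rw [h2] at h3
  rw [hnorm]
  rcases (norm_nonneg v).eq_or_lt with h | h
  · rw [← h]; exact norm_nonneg _
  · exact le_of_mul_le_mul_right (by rw [← sq]; exact h3) h

theorem classicalGrad_radial_eq_zero (hχ : IsStep χ L) (hd : 0 < d) (hρ : d < ρ) {x : Space m}
    (hx : x ∉ shell c ρ d) : classicalGrad (fun y => (radial χ c ρ d y : ℂ)) x = 0 := by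
  have h1 := norm_classicalGrad_ofReal_le
    ((contDiff_radial (c := c) hχ hd hρ).differentiable (by simp) x)
  rw [fderiv_radial_eq_zero hχ hd hx, norm_zero] at h1
  exact norm_le_zero_iff.1 h1

theorem norm_classicalGrad_radial_le (hχ : IsStep χ L) (hL : 0 ≤ L) (hd : 0 < d) (hρ : d < ρ)
    (x : Space m) : ‖classicalGrad (fun y => (radial χ c ρ d y : ℂ)) x‖ ≤ L / d :=
  (norm_classicalGrad_ofReal_le ((contDiff_radial hχ hd hρ).differentiable (by simp) x)).trans
    (norm_fderiv_radial_le hχ hL hd x)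

theorem isTest_radial {Ω : Set (Space m)} (hχ : IsStep χ L) (hd : 0 < d) (hρ : d < ρ)
    (hΩ : Metric.closedBall c ρ ⊆ Ω) : IsTest Ω fun x => (radial χ c ρ d x : ℂ) := by
  have h1 : Function.support (fun x => (radial χ c ρ d x : ℂ)) ⊆ Metric.closedBall c ρ := by
    intro x hx
    by_contra h
    refine hx ?_
    rw [Metric.mem_closedBall, not_le] at h
    simp only [radial_eq_zero hχ hd h.le, Complex.ofReal_zero]
  exact ⟨Complex.ofRealCLM.contDiff.comp (contDiff_radial hχ hd hρ),
    HasCompactSupport.of_support_subset_isCompact (isCompact_closedBall c ρ) h1,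
    (closure_minimal h1 Metric.isClosed_closedBall).trans hΩ⟩

end Radial

/-- A test function and its gradient form an element of `H¹₀(Ω)`. -/
theorem exists_mem_H10_of_isTest {Ω : Set (Space m)} {φ : Space m → ℂ} (hφ : IsTest Ω φ) :
    ∃ p ∈ H10 Ω, p.1 =ᵐ[volume.restrict Ω] φ ∧ p.2 =ᵐ[volume.restrict Ω] classicalGrad φ := by
  have h1 : MemLp φ 2 ((volume : Measure (Space m)).restrict Ω) :=
    hφ.1.continuous.memLp_of_hasCompactSupport hφ.2.1
  have h2 : MemLp (classicalGrad φ) 2 ((volume : Measure (Space m)).restrict Ω) := by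
    refine (continuous_classicalGrad (contDiff_one_of_isTest hφ)).memLp_of_hasCompactSupport ?_
    refine (hφ.2.1.fderiv (𝕜 := ℝ)).comp_left (g := fun L : Space m →L[ℝ] ℂ =>
      (WithLp.toLp 2 fun j => L (EuclideanSpace.single j 1) : Grad m)) ?_
    ext j; simp
  exact ⟨(h1.toLp, h2.toLp), Submodule.le_topologicalClosure _ (Submodule.subset_span
    ⟨φ, hφ, h1.coeFn_toLp, h2.coeFn_toLp⟩), h1.coeFn_toLp, h2.coeFn_toLp⟩

/-! ### The admissible lattice points -/

/-- A point whose distance to a point `c` of the set is less than that of `c` to the frontier lies in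
the set. -/
theorem mem_of_dist_lt_infDist_frontier {Ω : Set (Space m)} (hΩ : IsOpen Ω) {c x : Space m}
    (hc : c ∈ Ω) (hx : dist x c < Metric.infDist c (frontier Ω)) : x ∈ Ω := by
  have h1 : IsPreconnected (Metric.ball c (Metric.infDist c (frontier Ω))) :=
    (convex_ball _ _).isPreconnected
  refine h1.subset_left_of_subset_union hΩ (isClosed_closure (s := Ω)).isOpen_compl
    (Set.disjoint_left.2 fun y hy hy' => hy' (subset_closure hy)) (fun y hy => ?_)
    ⟨c, Metric.mem_ball_self (dist_nonneg.trans_lt hx), hc⟩ hx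
  by_contra h
  simp only [Set.mem_union, Set.mem_compl_iff, not_or, not_not] at h
  have h2 : y ∈ frontier Ω := by
    rw [hΩ.frontier_eq]
    exact ⟨h.2, h.1⟩
  have h3 := Metric.infDist_le_dist_of_mem (x := c) h2
  rw [dist_comm] at h3
  exact (h3.trans_lt hy).false

theorem closedBall_subset_of_mem_admissible {Ω : Set (Space m)} (hΩ : IsOpen Ω) {ε ρ : ℝ}
    (hε : 0 < ε) (hρ : ρ < ε / 2) {i : Fin m → ℤ} (hi : i ∈ admissible Ω ε) :
    Metric.closedBall (latticePoint ε i) ρ ⊆ Ω := by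
  intro x hx
  refine mem_of_dist_lt_infDist_frontier hΩ hi.1.1 (lt_of_lt_of_le ?_ hi.2)
  have h1 : 1 ≤ √((m : ℝ) + 1) := Real.one_le_sqrt.2 (by simp)
  have h2 : dist x (latticePoint ε i) ≤ ρ := hx
  nlinarith

theorem le_dist_latticePoint {ε : ℝ} (hε : 0 < ε) {i j : Fin m → ℤ} (hij : i ≠ j) :
    ε ≤ dist (latticePoint ε i) (latticePoint ε j) := by
  obtain ⟨t, ht⟩ := Function.ne_iff.1 hij
  have h1 := PiLp.norm_apply_le (latticePoint ε i - latticePoint ε j) t.castSucc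
  rw [dist_eq_norm]
  refine le_trans ?_ h1
  have h2 : (latticePoint ε i - latticePoint ε j) t.castSucc = ε * ((i t - j t : ℤ) : ℝ) := by
    simp [latticePoint, mul_sub]
  rw [h2, norm_mul, Real.norm_of_nonneg hε.le, Real.norm_eq_abs, ← Int.cast_abs]
  have h3 : (1 : ℝ) ≤ ((|i t - j t| : ℤ) : ℝ) := by
    exact_mod_cast Int.one_le_abs (sub_ne_zero.2 ht)
  nlinarith

theorem latticePoint_eq_smul (ε : ℝ) (i : Fin m → ℤ) :
    latticePoint ε i = ε • latticePoint 1 i := by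
  ext t
  refine Fin.lastCases ?_ (fun t => ?_) t <;> simp [latticePoint]

/-- Every lattice index becomes admissible as `ε → 0`, since `0` is an interior point of `Ω`. -/
theorem eventually_mem_admissible {Ω : Set (Space m)} (hΩ : IsOpen Ω)
    (hΩb : Bornology.IsBounded Ω) (h0 : (0 : Space m) ∈ Ω) (i : Fin m → ℤ) :
    ∀ᶠ ε in 𝓝[>] (0 : ℝ), i ∈ admissible Ω ε := by
  have hne : (frontier Ω).Nonempty := by
    refine nonempty_frontier_iff.2 ⟨⟨0, h0⟩, fun h => ?_⟩
    rw [h] at hΩb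
    exact NormedSpace.unbounded_univ ℝ (Space m) hΩb
  have hpos : 0 < Metric.infDist (0 : Space m) (frontier Ω) := by
    refine (isClosed_frontier.notMem_iff_infDist_pos hne).1 ?_
    rw [hΩ.frontier_eq]
    exact fun h => h.2 h0
  have hlim : Tendsto (fun ε => latticePoint ε i) (𝓝[>] (0 : ℝ)) (𝓝 0) := by
    refine Tendsto.mono_left ?_ nhdsWithin_le_nhds
    have h1 : Tendsto (fun ε : ℝ => ε • latticePoint (m := m) 1 i) (𝓝 0)
        (𝓝 ((0 : ℝ) • latticePoint 1 i)) := tendsto_id.smul_const _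
    rw [zero_smul] at h1
    exact h1.congr fun ε => (latticePoint_eq_smul ε i).symm
  have hdist : Tendsto (fun ε => Metric.infDist (latticePoint ε i) (frontier Ω) -
      ε * (√((m : ℝ) + 1) / 2)) (𝓝[>] (0 : ℝ))
      (𝓝 (Metric.infDist (0 : Space m) (frontier Ω) - 0 * (√((m : ℝ) + 1) / 2))) :=
    (((Metric.continuous_infDist_pt _).tendsto _).comp hlim).sub
      (((tendsto_id (α := ℝ)).mono_left nhdsWithin_le_nhds).mul_const _)
  rw [zero_mul, sub_zero] at hdist
  filter_upwards [hlim.eventually (hΩ.mem_nhds h0), hdist.eventually (lt_mem_nhds hpos)]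
    with ε h1 h2
  refine ⟨⟨h1, ?_⟩, (sub_pos.1 h2).le⟩
  simp [latticePoint]

/-- For small `ε` there are as many admissible lattice points as desired. -/
theorem eventually_exists_admissible (hm : 1 ≤ m) {Ω : Set (Space m)} (hΩ : IsOpen Ω)
    (hΩb : Bornology.IsBounded Ω) (h0 : (0 : Space m) ∈ Ω) (N : ℕ) :
    ∀ᶠ ε in 𝓝[>] (0 : ℝ), ∃ i : Fin N → Fin m → ℤ, Function.Injective i ∧
      ∀ j, i j ∈ admissible Ω ε := by
  have h1 : ∀ᶠ ε in 𝓝[>] (0 : ℝ), ∀ j : Fin N, (fun _ => (j : ℤ)) ∈ admissible Ω ε :=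
    eventually_all.2 fun j => eventually_mem_admissible hΩ hΩb h0 _
  filter_upwards [h1] with ε h
  refine ⟨fun j _ => (j : ℤ), fun j j' hj => ?_, h⟩
  have := congrFun hj ⟨0, hm⟩
  exact Fin.ext (Int.natCast_inj.1 this)

end TestFunctionsAndLattice

section Rayleigh

/-! ### Rayleigh quotients of the test functions -/

variable {m : ℕ}

theorem re_weighted_self (Ω : Set (Space m)) {F : Type} [NormedAddCommGroup F]
    [InnerProductSpace ℂ F] {w : Space m → ℝ} (hw : IsCoeff w) (u : L2 Ω F) :
    Integrable (fun x => w x * ‖u x‖ ^ 2) (volume.restrict Ω) ∧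
      (weighted Ω w u u).re = ∫ x in Ω, w x * ‖u x‖ ^ 2 := by
  have h1 := integrable_weighted Ω hw u u
  have h2 : ∀ x, ((w x : ℂ) * inner ℂ (u x) (u x)).re = w x * ‖u x‖ ^ 2 := fun x => by
    rw [inner_self_eq_ofReal, ← Complex.ofReal_mul, Complex.ofReal_re]
  refine ⟨by simpa only [RCLike.re_to_complex, h2] using h1.re, ?_⟩
  have h3 := integral_re h1
  simp only [RCLike.re_to_complex, h2] at h3
  exact h3.symm

theorem weighted_eq_zero_of_disjoint {Ω : Set (Space m)} {F : Type} [NormedAddCommGroup F]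
    [InnerProductSpace ℂ F] (w : Space m → ℝ) {u v : L2 Ω F}
    (h : ∀ᵐ x ∂(volume.restrict Ω), u x = 0 ∨ v x = 0) : weighted Ω w u v = 0 := by
  unfold weighted
  rw [← integral_zero (Space m) ℂ (μ := volume.restrict Ω)]
  refine integral_congr_ae (h.mono fun x hx => ?_)
  rcases hx with hx | hx <;> simp [hx]

theorem isEllipticCoeff_stepFun {S : Set (Space m)} {c : ℝ} (h : IsCoeff (stepFun S c))
    (hc : 0 < c) : IsEllipticCoeff (stepFun S c) := by
  refine ⟨h, min c 1, by positivity, fun x => ?_⟩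
  unfold stepFun
  split_ifs <;> simp

theorem stiffness_eq {Ω : Set (Space m)} {R ε d : ℝ} (α : ℝ) {i : Fin m → ℤ}
    (hi : i ∈ admissible Ω ε) {x : Space m} (hx : x ∈ shell (latticePoint ε i) (R * ε) d) :
    stiffness Ω R ε d α x = α :=
  if_pos (Set.mem_biUnion hi hx)

theorem density_eq {Ω : Set (Space m)} {R ε d : ℝ} (β : ℝ) {i : Fin m → ℤ}
    (hi : i ∈ admissible Ω ε) {x : Space m} (hx : x ∈ core (latticePoint ε i) (R * ε) d) :
    density Ω R ε d β x = β :=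
  if_pos (Set.mem_biUnion hi hx)

theorem measurableSet_shell (c : Space m) (ρ d : ℝ) : MeasurableSet (shell c ρ d) :=
  ((isOpen_lt continuous_const (continuous_id.dist continuous_const)).inter
    (isOpen_lt (continuous_id.dist continuous_const) continuous_const)).measurableSet

theorem volume_real_ball (c : Space m) {s : ℝ} (hs : 0 ≤ s) : volume.real (Metric.ball c s) =
    s ^ (m + 1) * volume.real (Metric.ball (0 : Space m) 1) := by
  rw [Measure.real, Measure.addHaar_ball _ _ hs, finrank_euclideanSpace_fin, ENNReal.toReal_mul,
    ENNReal.toReal_ofReal (by positivity), Measure.real]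

/-- By Bernoulli's inequality the shell is no larger than its outer area times its thickness. -/
theorem volume_real_shell_le (c : Space m) {ρ d : ℝ} (hd : 0 < d) (hρ : d < ρ) :
    volume.real (shell c ρ d) ≤
      ((m + 1 : ℕ) : ℝ) * d * ρ ^ m * volume.real (Metric.ball (0 : Space m) 1) := by
  have h0 : 0 < ρ := hd.trans hρ
  have h1 : shell c ρ d ⊆ Metric.ball c ρ \ Metric.closedBall c (ρ - d) := fun x hx =>
    ⟨hx.2, fun h => (lt_of_lt_of_le hx.1 h).false⟩
  have h2 : volume.real (shell c ρ d) ≤ volume.real (Metric.ball c ρ) -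
      volume.real (Metric.closedBall c (ρ - d)) := by
    rw [← measureReal_sdiff ((Metric.closedBall_subset_ball (by linarith)))
      Metric.isClosed_closedBall.measurableSet]
    exact measureReal_mono h1 (measure_ne_top_of_subset Set.sdiff_subset measure_ball_lt_top.ne)
  rw [volume_real_ball _ h0.le, Measure.addHaar_real_closedBall _ _ (by linarith),
    finrank_euclideanSpace_fin, ← sub_mul] at h2
  refine h2.trans (mul_le_mul_of_nonneg_right ?_ measureReal_nonneg)
  have h3 : d / ρ < 1 := (div_lt_one h0).2 hρ
  have h4 := one_add_mul_le_pow (a := -(d / ρ)) (by linarith) (m + 1)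
  have h5 : (ρ - d) ^ (m + 1) = ρ ^ (m + 1) * (1 + -(d / ρ)) ^ (m + 1) := by
    rw [← mul_pow]; congr 1; field_simp; ring
  have h6 := mul_le_mul_of_nonneg_left h4 (pow_nonneg h0.le (m + 1))
  have h7 : ρ ^ (m + 1) * (1 + ((m + 1 : ℕ) : ℝ) * -(d / ρ)) =
      ρ ^ (m + 1) - ((m + 1 : ℕ) : ℝ) * d * ρ ^ m := by
    field_simp
    ring
  rw [h5]
  linarith

section TestFunctions

variable {Ω : Set (Space m)} {χ : ℝ → ℝ} {L R ε d α β : ℝ} {i : Fin m → ℤ}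
  {p : L2 Ω ℂ × L2 Ω (Grad m)}

/-- The energy of a radial test function is carried by its shell. -/
theorem re_weighted_stiffness_le (hχ : IsStep χ L) (hL : 0 ≤ L) (hd : 0 < d) (hρ : d < R * ε)
    (hα : 0 < α) (hi : i ∈ admissible Ω ε)
    (hp : p.2 =ᵐ[volume.restrict Ω]
      classicalGrad fun x => (radial χ (latticePoint ε i) (R * ε) d x : ℂ)) :
    (weighted Ω (stiffness Ω R ε d α) p.2 p.2).re ≤ α * (L / d) ^ 2 *
      (((m + 1 : ℕ) : ℝ) * d * (R * ε) ^ m * volume.real (Metric.ball (0 : Space m) 1)) := by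
  obtain ⟨hint, hre⟩ := re_weighted_self Ω (isCoeff_stiffness Ω R ε d α) p.2
  set S := shell (latticePoint ε i) (R * ε) d with hS
  have hSm : MeasurableSet S := measurableSet_shell _ _ _
  have hSt : volume S ≠ ⊤ := measure_ne_top_of_subset
    (fun x hx => (hx.2 : dist x _ < _)) (measure_ball_lt_top (x := latticePoint ε i)).ne
  have hSt' : (volume.restrict Ω) S ≠ ⊤ :=
    ne_top_of_le_ne_top hSt (Measure.restrict_apply_le _ _)
  rw [hre]
  calc ∫ x in Ω, stiffness Ω R ε d α x * ‖p.2 x‖ ^ 2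
      ≤ ∫ x in Ω, S.indicator (fun _ => α * (L / d) ^ 2) x := by
        refine integral_mono_ae hint ((integrable_indicator_iff hSm).2
          (integrableOn_const hSt')) (hp.mono fun x hx => ?_)
        simp only [hx]
        by_cases hxS : x ∈ S
        · rw [Set.indicator_of_mem hxS, stiffness_eq α hi hxS]
          gcongr
          exact norm_classicalGrad_radial_le hχ hL hd hρ x
        · rw [Set.indicator_of_notMem hxS, classicalGrad_radial_eq_zero hχ hd hρ hxS]
          simp
    _ = (volume.restrict Ω).real S * (α * (L / d) ^ 2) := by
        rw [integral_indicator hSm, setIntegral_const, smul_eq_mul]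
    _ ≤ volume.real S * (α * (L / d) ^ 2) := by
        gcongr
        exact ENNReal.toReal_mono hSt (Measure.restrict_apply_le _ _)
    _ ≤ _ := by
        rw [mul_comm]
        gcongr
        exact volume_real_shell_le _ hd hρ

/-- The mass of a radial test function is at least that of its core. -/
theorem le_re_weighted_density (hΩ : IsOpen Ω) (hχ : IsStep χ L) (hε : 0 < ε) (hR : R < 1 / 2)
    (hd : 0 < d) (hρ : d < R * ε) (hβ : 0 < β) (hi : i ∈ admissible Ω ε)
    (hp : p.1 =ᵐ[volume.restrict Ω] fun x => (radial χ (latticePoint ε i) (R * ε) d x : ℂ)) :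
    β * ((R * ε - d) ^ (m + 1) * volume.real (Metric.ball (0 : Space m) 1)) ≤
      (weighted Ω (density Ω R ε d β) p.1 p.1).re := by
  obtain ⟨hint, hre⟩ := re_weighted_self Ω (isCoeff_density Ω R ε d β) p.1
  set S := Metric.ball (latticePoint ε i) (R * ε - d) with hS
  have hSm : MeasurableSet S := Metric.isOpen_ball.measurableSet
  have hSΩ : S ⊆ Ω := (Metric.ball_subset_closedBall.trans
    (Metric.closedBall_subset_closedBall (by linarith))).trans
    (closedBall_subset_of_mem_admissible hΩ hε (by nlinarith : R * ε < ε / 2) hi)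
  have hSt' : (volume.restrict Ω) S ≠ ⊤ :=
    ne_top_of_le_ne_top measure_ball_lt_top.ne (Measure.restrict_apply_le _ _)
  rw [hre]
  calc β * ((R * ε - d) ^ (m + 1) * volume.real (Metric.ball (0 : Space m) 1))
      = ∫ x in Ω, S.indicator (fun _ => β) x := by
        rw [integral_indicator hSm, setIntegral_const, smul_eq_mul,
          measureReal_restrict_apply hSm, Set.inter_eq_left.2 hSΩ, hS,
          volume_real_ball (latticePoint ε i) (by linarith), mul_comm]
    _ ≤ _ := by
        refine integral_mono_ae ((integrable_indicator_iff hSm).2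
          (integrableOn_const hSt')) hint (hp.mono fun x hx => ?_)
        simp only [hx]
        by_cases hxS : x ∈ S
        · have h1 : dist x (latticePoint ε i) < R * ε - d := hxS
          rw [Set.indicator_of_mem hxS, density_eq β hi h1, radial_eq_one hχ hd h1.le]
          simp
        · rw [Set.indicator_of_notMem hxS]
          have := (isEllipticCoeff_stepFun (isCoeff_density Ω R ε d β) hβ).pos x
          exact mul_nonneg this.le (sq_nonneg _)

/-- Test functions around different lattice points have disjoint supports. -/
theorem radial_disjoint (hχ : IsStep χ L) (hε : 0 < ε) (hR : R < 1 / 2) (hd : 0 < d)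
    (hρ : d < R * ε) {j : Fin m → ℤ} (hij : i ≠ j) (x : Space m) :
    (radial χ (latticePoint ε i) (R * ε) d x = 0 ∧
      classicalGrad (fun x => (radial χ (latticePoint ε i) (R * ε) d x : ℂ)) x = 0) ∨
    (radial χ (latticePoint ε j) (R * ε) d x = 0 ∧
      classicalGrad (fun x => (radial χ (latticePoint ε j) (R * ε) d x : ℂ)) x = 0) := by
  have h1 : ∀ i : Fin m → ℤ, R * ε ≤ dist x (latticePoint ε i) →
      radial χ (latticePoint ε i) (R * ε) d x = 0 ∧
      classicalGrad (fun x => (radial χ (latticePoint ε i) (R * ε) d x : ℂ)) x = 0 := fun i h =>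
    ⟨radial_eq_zero hχ hd h, classicalGrad_radial_eq_zero hχ hd hρ fun h' =>
      (h'.2.trans_le h).false⟩
  rcases le_or_gt (R * ε) (dist x (latticePoint ε i)) with h | h
  · exact Or.inl (h1 i h)
  · refine Or.inr (h1 j ?_)
    have h2 := le_dist_latticePoint hε hij
    have h3 := dist_triangle_left (latticePoint ε i) (latticePoint ε j) x
    nlinarith

/-- A family of test functions around different lattice points, orthogonal for all weights. -/
theorem exists_radial_family (hΩ : IsOpen Ω) (hχ : IsStep χ L) (hε : 0 < ε) (hR : R < 1 / 2)
    (hd : 0 < d) (hρ : d < R * ε) {N : ℕ} {i : Fin N → Fin m → ℤ} (hinj : Function.Injective i)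
    (hi : ∀ j, i j ∈ admissible Ω ε) :
    ∃ p : Fin N → L2 Ω ℂ × L2 Ω (Grad m), (∀ j, p j ∈ H10 Ω ∧
      (p j).1 =ᵐ[volume.restrict Ω]
        (fun x => (radial χ (latticePoint ε (i j)) (R * ε) d x : ℂ)) ∧
      (p j).2 =ᵐ[volume.restrict Ω]
        classicalGrad fun x => (radial χ (latticePoint ε (i j)) (R * ε) d x : ℂ)) ∧
      Pairwise fun j k => ∀ w, weighted Ω w (p j).1 (p k).1 = 0 ∧
        weighted Ω w (p j).2 (p k).2 = 0 := by
  choose p hp using fun j => exists_mem_H10_of_isTest (isTest_radial hχ hd hρ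
    (closedBall_subset_of_mem_admissible hΩ hε (by nlinarith : R * ε < ε / 2) (hi j)))
  refine ⟨p, fun j => hp j, fun j k hjk w => ⟨weighted_eq_zero_of_disjoint w ?_,
    weighted_eq_zero_of_disjoint w ?_⟩⟩
  · filter_upwards [(hp j).2.1, (hp k).2.1] with x h1 h2
    rw [h1, h2]
    exact (radial_disjoint hχ hε hR hd hρ (hinj.ne hjk) x).imp
      (fun h => by simp [h.1]) fun h => by simp [h.1]
  · filter_upwards [(hp j).2.2, (hp k).2.2] with x h1 h2
    rw [h1, h2]
    exact (radial_disjoint hχ hε hR hd hρ (hinj.ne hjk) x).imp (fun h => h.2) fun h => h.2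

theorem fst_ne_zero_of_radial (hΩ : IsOpen Ω) (hχ : IsStep χ L) (hε : 0 < ε) (hR : R < 1 / 2)
    (hd : 0 < d) (hρ : d < R * ε) (hi : i ∈ admissible Ω ε)
    (hp : p.1 =ᵐ[volume.restrict Ω] fun x => (radial χ (latticePoint ε i) (R * ε) d x : ℂ)) :
    p.1 ≠ 0 := by
  intro h0
  have h1 := le_re_weighted_density hΩ hχ hε hR hd hρ one_pos hi hp
  rw [h0, weighted_eq_zero_of_disjoint _ ((Lp.coeFn_zero ℂ 2 _).mono fun x hx => Or.inl hx),
    Complex.zero_re] at h1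
  have h2 : 0 < volume.real (Metric.ball (0 : Space m) 1) :=
    ENNReal.toReal_pos (Metric.measure_ball_pos _ _ one_pos).ne' measure_ball_lt_top.ne
  have h3 : 0 < (R * ε - d) ^ (m + 1) := pow_pos (by linarith) _
  have := mul_pos h3 h2
  linarith

end TestFunctions

/-- `H¹₀(Ω)` is infinite-dimensional. -/
theorem exists_linearIndependent_H10 (hm : 1 ≤ m) {Ω : Set (Space m)} (hΩ : IsOpen Ω)
    (hΩb : Bornology.IsBounded Ω) (h0 : (0 : Space m) ∈ Ω) (N : ℕ) :
    ∃ p : Fin N → L2 Ω ℂ × L2 Ω (Grad m), (∀ i, p i ∈ H10 Ω) ∧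
      LinearIndependent ℂ fun i => (p i).1 := by
  obtain ⟨ε, ⟨i, hinj, hi⟩, hε⟩ := ((eventually_exists_admissible hm hΩ hΩb h0 N).and
    self_mem_nhdsWithin).exists
  have hε : 0 < ε := hε
  obtain ⟨χ, hχ⟩ := exists_isStep one_pos
  have hρ : ε / 8 < 1 / 4 * ε := by linarith
  obtain ⟨p, hp, horth⟩ := exists_radial_family hΩ hχ hε (by norm_num : (1 / 4 : ℝ) < 1 / 2)
    (by positivity : 0 < ε / 8) hρ hinj hi
  refine ⟨p, fun j => (hp j).1, linearIndependent_of_ne_zero_of_inner_eq_zero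
    (fun j => fst_ne_zero_of_radial hΩ hχ hε (by norm_num) (by positivity) hρ (hi j) (hp j).2.1)
    fun j k hjk => ?_⟩
  have h1 := (horth hjk.symm fun _ => 1).1
  change inner ℂ (p j).1 (p k).1 = 0
  rw [L2.inner_def, ← h1]
  simp [weighted]

/-- The upper bound for the eigenvalue with index `k` once there are `k + 1` shells. -/
theorem eigenvalue_shellOperator_le {Ω : Set (Space m)} (hΩ : IsOpen Ω)
    (hΩb : Bornology.IsBounded Ω) {R ε d α β : ℝ} (hR : R < 1 / 2) (hε : 0 < ε)
    (hd : 0 < d) (hρ : d < R * ε) (hα : 0 < α) (hβ : 0 < β) {k : ℕ}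
    {i : Fin (k + 1) → Fin m → ℤ} (hinj : Function.Injective i) (hi : ∀ j, i j ∈ admissible Ω ε)
    {l : ℕ → ℝ} (hl : IsEigenvalueSequence (shellOperator Ω R ε d α β) l) {δ : ℝ} (hδ : 0 < δ) :
    l k ≤ (1 + δ) ^ 2 * (α * ((m + 1 : ℕ) : ℝ) / (R * d * ε * β)) *
      (R / (R - d / ε)) ^ (m + 1) := by
  obtain ⟨χ, hχ⟩ := exists_isStep hδ
  obtain ⟨p, hp, horth⟩ := exists_radial_family hΩ hχ hε hR hd hρ hinj hi
  have ha := isEllipticCoeff_stepFun (isCoeff_stiffness Ω R ε d α) hα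
  have hb := isEllipticCoeff_stepFun (isCoeff_density Ω R ε d β) hβ
  refine eigenvalue_le_of_orthogonal hΩ hΩb ha hb hl p (fun j => (hp j).1)
    (fun j => fst_ne_zero_of_radial hΩ hχ hε hR hd hρ (hi j) (hp j).2.1)
    (fun j j' hjj' => ⟨(horth hjj' _).1, (horth hjj' _).2⟩) fun j => ?_
  have hR0 : 0 < R := pos_of_mul_pos_left (hd.trans hρ) hε.le
  have hRd : 0 < R - d / ε := by
    rw [sub_pos, div_lt_iff₀ hε]; exact hρ
  refine (re_weighted_stiffness_le hχ (by positivity) hd hρ hα (hi j) (hp j).2.2).trans ?_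
  refine le_trans (le_of_eq ?_) (mul_le_mul_of_nonneg_left
    (le_re_weighted_density hΩ hχ hε hR hd hρ hβ (hi j) (hp j).2.1) (by positivity))
  have h1 : R * ε - d = (R - d / ε) * ε := by field_simp
  rw [h1]
  generalize R - d / ε = t at hRd
  have h2 : (R / t) ^ (m + 1) * (t * ε) ^ (m + 1) = (R * ε) ^ (m + 1) := by
    rw [← mul_pow]
    congr 1
    field_simp
  rw [mul_assoc ((1 + δ) ^ 2 * _), mul_left_comm _ β, ← mul_assoc (_ ^ (m + 1)), h2, pow_succ]
  field_simp
  ring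

end Rayleigh

end DoubleContrast

end

open DoubleContrast in
theorem theorem2 {m : ℕ} (hm : 1 ≤ m)
    (Ω : Set (DoubleContrast.Space m)) (hΩ_open : IsOpen Ω)
    (hΩ_bounded : Bornology.IsBounded Ω) (hΩ_zero : (0 : DoubleContrast.Space m) ∈ Ω)
    (R : ℝ) (hR_pos : 0 < R) (hR_lt : R < 1 / 2)
    (d α β : ℝ → ℝ)
    (hd_pos : ∀ᶠ ε in 𝓝[>] (0 : ℝ), 0 < d ε)
    (hα_pos : ∀ᶠ ε in 𝓝[>] (0 : ℝ), 0 < α ε)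
    (hβ_pos : ∀ᶠ ε in 𝓝[>] (0 : ℝ), 0 < β ε)
    (hd : d =o[𝓝[>] (0 : ℝ)] (fun ε : ℝ => ε))
    (hdα : Tendsto (fun ε => d ε ^ 2 / α ε) (𝓝[>] (0 : ℝ)) (𝓝 0))
    (q : ℝ≥0∞)
    (hq : Tendsto
      (fun ε => ENNReal.ofReal (α ε * ((m + 1 : ℕ) : ℝ) / (R * d ε * ε * β ε)))
      (𝓝[>] (0 : ℝ)) (𝓝 q))
    (r : ℝ)
    (hr : Tendsto
      (fun ε => R ^ (m + 1) *
        (volume (Metric.ball (0 : DoubleContrast.Space m) 1)).toReal * ε * β ε)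
      (𝓝[>] (0 : ℝ)) (𝓝 r)) :
    (∀ᶠ ε in 𝓝[>] (0 : ℝ), ∃ l : ℕ → ℝ,
      DoubleContrast.IsEigenvalueSequence
        (DoubleContrast.shellOperator Ω R ε (d ε) (α ε) (β ε)) l) ∧
    ∀ lam : ℝ → ℕ → ℝ,
      (∀ᶠ ε in 𝓝[>] (0 : ℝ), DoubleContrast.IsEigenvalueSequence
        (DoubleContrast.shellOperator Ω R ε (d ε) (α ε) (β ε)) (lam ε)) →
      (⨆ k : ℕ, limsup (fun ε => ((lam ε k : ℝ) : EReal)) (𝓝[>] (0 : ℝ))) ≤ (q : EReal) ∧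
      (q = 0 → ∀ k : ℕ, Tendsto (fun ε => lam ε k) (𝓝[>] (0 : ℝ)) (𝓝 0)) := by
  have hε_pos : ∀ᶠ ε in 𝓝[>] (0 : ℝ), 0 < ε := self_mem_nhdsWithin
  refine ⟨?_, fun lam hlam => ?_⟩
  · filter_upwards [hα_pos, hβ_pos] with ε hα hβ
    exact exists_isEigenvalueSequence hΩ_open hΩ_bounded
      (isEllipticCoeff_stepFun (isCoeff_stiffness Ω R ε (d ε) (α ε)) hα)
      (isEllipticCoeff_stepFun (isCoeff_density Ω R ε (d ε) (β ε)) hβ)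
      (exists_linearIndependent_H10 hm hΩ_open hΩ_bounded hΩ_zero)
  have hdε : Tendsto (fun ε => d ε / ε) (𝓝[>] (0 : ℝ)) (𝓝 0) := hd.tendsto_div_nhds_zero
  -- every number above a finite `q` eventually bounds each eigenvalue
  have key : ∀ (k : ℕ) (c : ℝ), q < ENNReal.ofReal c →
      ∀ᶠ ε in 𝓝[>] (0 : ℝ), lam ε k ≤ c := by
    intro k c hqc
    have hqt : q ≠ ⊤ := hqc.ne_top
    have hc : q.toReal < c := by
      by_contra! h
      exact absurd hqc (not_lt.2 ((ENNReal.ofReal_le_ofReal h).trans_eq (ENNReal.ofReal_toReal hqt)))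
    have hX : Tendsto (fun ε => α ε * ((m + 1 : ℕ) : ℝ) / (R * d ε * ε * β ε))
        (𝓝[>] (0 : ℝ)) (𝓝 q.toReal) := by
      refine ((ENNReal.tendsto_toReal hqt).comp hq).congr' ?_
      filter_upwards [hε_pos, hd_pos, hα_pos, hβ_pos] with ε h1 h2 h3 h4
      exact ENNReal.toReal_ofReal (by positivity)
    have hY : Tendsto (fun ε => (R / (R - d ε / ε)) ^ (m + 1)) (𝓝[>] (0 : ℝ)) (𝓝 1) := by
      have h1 : Tendsto (fun ε => (R / (R - d ε / ε)) ^ (m + 1)) (𝓝[>] (0 : ℝ))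
          (𝓝 ((R / (R - 0)) ^ (m + 1))) :=
        ((tendsto_const_nhds.div (tendsto_const_nhds.sub hdε) (by simpa using hR_pos.ne')).pow _)
      rwa [sub_zero, div_self hR_pos.ne', one_pow] at h1
    obtain ⟨δ, hδ, hδc⟩ : ∃ δ : ℝ, 0 < δ ∧ (1 + δ) ^ 2 * q.toReal < c := by
      have h1 : Tendsto (fun δ : ℝ => (1 + δ) ^ 2 * q.toReal) (𝓝[>] 0)
          (𝓝 ((1 + 0) ^ 2 * q.toReal)) :=
        (((tendsto_id.mono_left nhdsWithin_le_nhds).const_add 1).pow 2).mul_const _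
      rw [add_zero, one_pow, one_mul] at h1
      obtain ⟨δ, h2, h3⟩ := ((h1.eventually (gt_mem_nhds hc)).and self_mem_nhdsWithin).exists
      exact ⟨δ, h3, h2⟩
    have hZ := ((hX.const_mul ((1 + δ) ^ 2)).mul hY)
    rw [mul_one] at hZ
    filter_upwards [hlam, hε_pos, hd_pos, hα_pos, hβ_pos, hdε.eventually (gt_mem_nhds hR_pos),
      hZ.eventually (gt_mem_nhds hδc),
      eventually_exists_admissible hm hΩ_open hΩ_bounded hΩ_zero (k + 1)]
      with ε hl hε hdp hα hβ hdR hlt ⟨i, hinj, hi⟩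
    exact (eigenvalue_shellOperator_le hΩ_open hΩ_bounded hR_lt hε hdp ((div_lt_iff₀ hε).1 hdR)
      hα hβ hinj hi hl hδ).trans hlt.le
  refine ⟨iSup_le fun k => ?_, fun hq0 k => ?_⟩
  · refine EReal.le_of_forall_lt_iff_le.1 fun c hc => ?_
    refine limsup_le_of_le (h := ?_)
    have h1 : q < ENNReal.ofReal c := by
      have h2 : (0 : EReal) ≤ c := (EReal.coe_ennreal_nonneg q).trans hc.le
      have h3 : (0 : ℝ) ≤ c := by exact_mod_cast h2
      rw [← EReal.coe_ennreal_lt_coe_ennreal_iff, EReal.coe_ennreal_ofReal, max_eq_left h3]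
      exact hc
    filter_upwards [key k c h1] with ε h
    exact_mod_cast h
  · refine tendsto_order.2 ⟨fun c hc => ?_, fun c hc => ?_⟩
    · filter_upwards [hlam, hα_pos, hβ_pos] with ε hl hα hβ
      exact hc.trans_le (eigenvalue_nonneg hΩ_open
        (isEllipticCoeff_stepFun (isCoeff_stiffness Ω R ε (d ε) (α ε)) hα)
        (isEllipticCoeff_stepFun (isCoeff_density Ω R ε (d ε) (β ε)) hβ) hl k)
    · filter_upwards [key k (c / 2) (by rw [hq0]; simpa using hc)] with ε h
      linarith
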